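/- Let $s\ge 2$ and $t$ be coprime natural numbers, let $u=\lfloor s/2\rfloor$ and $c=\tfrac12(s-1)(t-1)$. \emph{Groups.} Let $W_s$ be the affine symmetric group, i.e. the group of permutations $w$ of $\mathbb Z$ with $w(m+s)=w(m)+s$ for all $m$ and $w(0)+\dots+w(s-1)=\binom s2$. For $i\in\mathbb Z/s\mathbb Z$ (regarded as a subset of $\mathbb Z$) let $w_i\in W_s$ be given by $w_i(m)=m+1$ if $m\in i-1$, $w_i(m)=m-1$ if $m\in i$, and $w_i(m)=m$ otherwise; these elements generate $W_s$. Let $v_i=w_i$ if $i=0$, $v_i=w_iw_{-i}w_i$ if $i=\pm u$, and $v_i=w_iw_{-i}$ otherwise, and let $H_s\le W_s$ be the subgroup generated by all $v_i$ (the affine hyperoctahedral group of degree $u$). The level $t$ action $w\mapsto\bar w$ of $W_s$ (and of $H_s$) on $\mathbb Z$ is the action with $\bar w_i(m)=m+t$ if $m\in(i-1)t-c$, $\bar w_i(m)=m-t$ if $m\in it-c$, and $\bar w_i(m)=m$ otherwise. \emph{Cores.} The beta-set of a partition $\lambda$ is $\mathcal B(\lambda)=\{\lambda_i-i: i\ge1\}$.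 An $s$-core is a partition none of whose hook lengths equals $s$; let $\mathcal D_s$ be the set of $s$-cores that equal their conjugate. The $s$-set $\mathcal S(\lambda)$ of an $s$-core $\lambda$ consists, for each class $i\in\mathbb Z/s\mathbb Z$, of the smallest integer in $i$ not lying in $\mathcal B(\lambda)$. The group $H_s$ acts on $\mathcal D_s$ (the level $t$ action) by $\mathcal B(\check w\lambda)=\bar w\,\mathcal B(\lambda)$; let $\operatorname{StabSC}_{s,t}(\lambda)$ be the stabiliser of $\lambda\in\mathcal D_s$ under this action. For $N\ge1$ let $\mathcal D_s^{(N)}$ be the set of $\lambda\in\mathcal D_s$ with $k-l<Ns$ for all $k,l\in\mathcal S(\lambda)$, and for $s$-cores $\lambda,\mu$ write $\lambda\equiv_N\mu$ if there is a bijection $\phi:\mathcal S(\lambda)\to\mathcal S(\mu)$ with $\phi(k)\equiv k\pmod{Ns}$ for all $k$. The level $t$ action of $H_s$ on $\mathcal D_s^{(N)}$ sends $\lambda$ under $w$ to the unique $\hat w\lambda\in\mathcal D_s^{(N)}$ with $\hat w\lambda\equiv_N\check w\lambda$. \emph{Statement.} Let $n\ge1$ and $\lambda\in\mathcal D_s^{(nt)}$.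 Then $\operatorname{StabSC}_{s,t}(\lambda)$ is finite, and the orbit containing $\lambda$ under the level $t$ action of $H_s$ on $\mathcal D_s^{(nt)}$ is finite of size $$\frac{(2n)^u\,u!}{|\operatorname{StabSC}_{s,t}(\lambda)|}.$$ -/

import Mathlib

namespace SCCore

/-! ### Partitions, hooks, beta-sets -/

/-- The beta-set `{λ_i - i : i ≥ 1}` of a partition (rows are indexed from `0` here). -/
def betaSet (lam : YoungDiagram) : Set ℤ :=
  Set.range fun i : ℕ => (lam.rowLen i : ℤ) - (i + 1)

/-- The hook length `1 + (λ_r - r) + (λ'_c - c)` of the cell `(r, c)`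
(the cell is indexed from `0`, hence the shift). -/
def hookLength (lam : YoungDiagram) (r c : ℕ) : ℤ :=
  1 + ((lam.rowLen r : ℤ) - (r + 1)) + ((lam.colLen c : ℤ) - (c + 1))

/-- `λ` is an `s`-core: no hook length equals `s`. -/
def IsCore (s : ℕ) (lam : YoungDiagram) : Prop :=
  ∀ r c : ℕ, (r, c) ∈ lam → hookLength lam r c ≠ s

/-- `λ` equals its conjugate partition. -/
def IsSelfConjugate (lam : YoungDiagram) : Prop := lam.transpose = lam

/-- The `s`-set of `λ`: for each congruence class modulo `s`, the smallest integer in the class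
that does not lie in the beta-set. -/
def sSet (s : ℕ) (lam : YoungDiagram) : Set ℤ :=
  {a | IsLeast {b : ℤ | b ≡ a [ZMOD s] ∧ b ∉ betaSet lam} a}

/-- The self-conjugate `s`-cores. -/
@[ext]
structure SelfConjCore (s : ℕ) where
  /-- the underlying partition -/
  diagram : YoungDiagram
  isCore : IsCore s diagram
  isSelfConjugate : IsSelfConjugate diagram

/-- The self-conjugate `s`-cores `λ` with `k - l < N s` for all `k, l` in the `s`-set of `λ`. -/
@[ext]
structure BoundedSelfConjCore (s N : ℕ) where
  /-- the underlying self-conjugate `s`-core -/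
  core : SelfConjCore s
  spread_lt : ∀ k ∈ sSet s core.diagram, ∀ l ∈ sSet s core.diagram, k - l < (N : ℤ) * s

/-- The equivalence relation `≡_N` on `s`-cores: there is a bijection between the `s`-sets
that fixes every element modulo `N s`. -/
def CoreEquiv (s N : ℕ) (lam mu : YoungDiagram) : Prop :=
  ∃ φ : sSet s lam ≃ sSet s mu, ∀ k : sSet s lam, (φ k : ℤ) ≡ (k : ℤ) [ZMOD ((N : ℤ) * s)]

theorem betaSet_injective : Function.Injective betaSet := by
  intro lam mu h
  have key : (fun i : ℕ => -((lam.rowLen i : ℤ) - (i + 1)))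
      = fun i : ℕ => -((mu.rowLen i : ℤ) - (i + 1)) := by
    have mono : ∀ nu : YoungDiagram,
        StrictMono (fun i : ℕ => -((nu.rowLen i : ℤ) - (i + 1))) := by
      intro nu
      refine strictMono_nat_of_lt_succ fun i => ?_
      have := nu.rowLen_anti i (i + 1) (Nat.le_succ i)
      push_cast
      omega
    refine (StrictMono.range_inj (mono lam) (mono mu)).1 ?_
    have e : ∀ nu : YoungDiagram,
        Set.range (fun i : ℕ => -((nu.rowLen i : ℤ) - (i + 1))) = Neg.neg '' betaSet nu := by
      intro nu
      rw [betaSet, ← Set.range_comp]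
      rfl
    rw [e, e, h]
  ext ⟨i, j⟩
  have hi := congrFun key i
  simp only [YoungDiagram.mem_cells, YoungDiagram.mem_iff_lt_rowLen]
  omega

theorem notMem_betaSet_iff (lam : YoungDiagram) (x : ℤ) :
    x ∉ betaSet lam ↔ ∃ j : ℕ, x = (j : ℤ) - lam.colLen j := by
  have cell : ∀ r j : ℕ, j < lam.rowLen r ↔ r < lam.colLen j := fun r j => by
    rw [← YoungDiagram.mem_iff_lt_rowLen, ← YoungDiagram.mem_iff_lt_colLen]
  constructor
  · intro hx
    have ex : ∃ r : ℕ, (lam.rowLen r : ℤ) - (r + 1) < x := by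
      refine ⟨lam.rowLen 0 + x.natAbs, ?_⟩
      have := lam.rowLen_anti 0 (lam.rowLen 0 + x.natAbs) (Nat.zero_le _)
      have := neg_abs_le x
      push_cast
      omega
    classical
    obtain ⟨h1, h2⟩ := Nat.find_spec ex, @Nat.find_min _ _ ex
    set r := Nat.find ex with hr
    have hnn : 0 ≤ x + r := by omega
    refine ⟨(x + r).toNat, ?_⟩
    have hle : lam.colLen (x + r).toNat ≤ r := by
      by_contra hlt
      rw [not_le, ← cell] at hlt
      omega
    have hge : r ≤ lam.colLen (x + r).toNat := by
      rcases Nat.eq_zero_or_pos r with h0 | hpos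
      · omega
      · have h3 := h2 (m := r - 1) (by omega)
        have h4 : (lam.rowLen (r - 1) : ℤ) - ((r - 1 : ℕ) + 1) ≠ x := fun h => hx ⟨r - 1, h⟩
        have h5 : (x + r).toNat < lam.rowLen (r - 1) := by omega
        rw [cell] at h5
        omega
    omega
  · rintro ⟨j, rfl⟩ ⟨r, hr⟩
    have := cell r j
    simp only at hr
    omega

theorem mem_betaSet_transpose (lam : YoungDiagram) (x : ℤ) :
    x ∈ betaSet lam.transpose ↔ -1 - x ∉ betaSet lam := by
  rw [notMem_betaSet_iff]
  simp only [betaSet, Set.mem_range, YoungDiagram.rowLen_transpose]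
  constructor
  · rintro ⟨i, hi⟩
    exact ⟨i, by omega⟩
  · rintro ⟨i, hi⟩
    exact ⟨i, by omega⟩

theorem isSelfConjugate_iff (lam : YoungDiagram) :
    IsSelfConjugate lam ↔ ∀ x, x ∈ betaSet lam ↔ -1 - x ∉ betaSet lam := by
  rw [IsSelfConjugate, ← betaSet_injective.eq_iff, Set.ext_iff]
  simp only [mem_betaSet_transpose]
  exact forall_congr' fun x => Iff.comm

theorem isCore_iff {s : ℕ} (hs : 0 < s) (lam : YoungDiagram) :
    IsCore s lam ↔ ∀ b ∈ betaSet lam, b - s ∈ betaSet lam := by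
  constructor
  · rintro h _ ⟨r, rfl⟩
    by_contra hb
    obtain ⟨j, hj⟩ := (notMem_betaSet_iff _ _).1 hb
    simp only at hj
    have cell : j < lam.rowLen r ↔ r < lam.colLen j := by
      rw [← YoungDiagram.mem_iff_lt_rowLen, ← YoungDiagram.mem_iff_lt_colLen]
    refine h r j (YoungDiagram.mem_iff_lt_rowLen.2 (by omega)) ?_
    rw [hookLength]
    omega
  · intro h r c hrc heq
    have hb : (lam.rowLen r : ℤ) - (r + 1) - s ∉ betaSet lam :=
      (notMem_betaSet_iff _ _).2 ⟨c, by rw [hookLength] at heq; omega⟩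
    exact hb (h _ ⟨r, rfl⟩)

theorem exists_rowLen_eq (f : ℕ → ℕ) (hf : Antitone f) (M : ℕ) (hM : ∀ i, M ≤ i → f i = 0) :
    ∃ lam : YoungDiagram, ∀ i, lam.rowLen i = f i := by
  let lam : YoungDiagram :=
    { cells := (Finset.range M ×ˢ Finset.range (f 0)).filter fun p => p.2 < f p.1
      isLowerSet := by
        rintro ⟨a, b⟩ ⟨c, d⟩ ⟨h1, h2⟩ h
        simp only [Finset.coe_filter, Finset.mem_product, Finset.mem_range,
          Set.mem_ofPred_eq] at h h1 h2 ⊢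
        have := hf h1
        have := hf (Nat.zero_le c)
        omega }
  have hm : ∀ i j, (i, j) ∈ lam ↔ j < f i := by
    intro i j
    rw [← YoungDiagram.mem_cells]
    simp only [lam, Finset.mem_filter, Finset.mem_product, Finset.mem_range]
    have := hf (Nat.zero_le i)
    have := hM i
    omega
  refine ⟨lam, fun i => ?_⟩
  have h : ∀ j, j < lam.rowLen i ↔ j < f i := fun j => by
    rw [← YoungDiagram.mem_iff_lt_rowLen, hm]
  have h1 := h (f i)
  have h2 := h (lam.rowLen i)
  omega

/-- A set of integers that is bounded above and symmetric is the beta-set of a partition. -/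
theorem exists_betaSet_eq (X : Set ℤ) (hsym : ∀ x, x ∈ X ↔ -1 - x ∉ X) (hbd : BddAbove X) :
    ∃ lam : YoungDiagram, betaSet lam = X := by
  classical
  obtain ⟨B, hB⟩ : ∃ B : ℕ, ∀ x ∈ X, x ≤ B := by
    obtain ⟨b, hb⟩ := hbd
    exact ⟨b.toNat, fun x hx => (hb hx).trans (Int.self_le_toNat b)⟩
  have hlow : ∀ x : ℤ, x < -1 - B → x ∈ X := by
    intro x hx
    rw [hsym]
    intro h
    have := hB _ h
    omega
  let p : ℕ → Prop := fun k => (B : ℤ) - k ∈ X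
  have hcount : ∀ L : ℕ, B < L → Nat.count p (B + 1 + L) = L := by
    intro L hL
    rw [Nat.count_eq_card_filter_range]
    have e1 : ((Finset.range (B + 1 + L)).filter p).card
        = ((Finset.Ico (-(L : ℤ)) L).filter (· ∈ X)).card := by
      refine Finset.card_bij' (fun k _ => (B : ℤ) - k) (fun x _ => ((B : ℤ) - x).toNat)
        ?_ ?_ ?_ ?_
      · intro k hk
        simp only [Finset.mem_filter, Finset.mem_range, Finset.mem_Ico, p] at hk ⊢
        exact ⟨by omega, hk.2⟩
      · intro x hx
        simp only [Finset.mem_filter, Finset.mem_range, Finset.mem_Ico, p] at hx ⊢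
        have := hB x hx.2
        have e : (B : ℤ) - (((B : ℤ) - x).toNat : ℤ) = x := by omega
        exact ⟨by omega, by rw [e]; exact hx.2⟩
      · intro k hk
        simp
      · intro x hx
        simp only [Finset.mem_filter, Finset.mem_Ico] at hx
        have := hB x hx.2
        omega
    have e2 : ((Finset.Ico (-(L : ℤ)) L).filter (· ∈ X)).card
        = ((Finset.Ico (-(L : ℤ)) L).filter (· ∉ X)).card := by
      refine Finset.card_bij' (fun x _ => -1 - x) (fun x _ => -1 - x) ?_ ?_ ?_ ?_
      · intro x hx
        simp only [Finset.mem_filter, Finset.mem_Ico] at hx ⊢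
        exact ⟨by omega, (hsym x).1 hx.2⟩
      · intro x hx
        simp only [Finset.mem_filter, Finset.mem_Ico] at hx ⊢
        refine ⟨by omega, (hsym _).2 ?_⟩
        have e : -1 - (-1 - x) = x := by ring
        rw [e]
        exact hx.2
      · intro x _
        ring
      · intro x _
        ring
    have e3 := Finset.card_filter_add_card_filter_not (s := Finset.Ico (-(L : ℤ)) L) (· ∈ X)
    have e4 : (Finset.Ico (-(L : ℤ)) L).card = 2 * L := by
      rw [Int.card_Ico]
      omega
    have e5 : ((Finset.range (B + 1 + L)).filter p).card = L := by omega
    convert e5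
  have hinf : Set.Infinite {k | p k} := by
    refine Set.infinite_of_not_bddAbove ?_
    rintro ⟨b, hb⟩
    have : b + 2 * B + 2 ∈ {k | p k} := by
      apply hlow
      push_cast
      omega
    have := hb this
    omega
  have hmono : StrictMono (Nat.nth p) := Nat.nth_strictMono hinf
  have hrange : Set.range (Nat.nth p) = {k | p k} := Nat.range_nth_of_infinite hinf
  have hnth : ∀ L : ℕ, B < L → Nat.nth p L = B + 1 + L := by
    intro L hL
    have hp : p (B + 1 + L) := by
      apply hlow
      push_cast
      omega
    have := Nat.nth_count hp
    rwa [hcount L hL] at this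
  have hle : ∀ i, Nat.nth p i ≤ B + 1 + i := by
    intro i
    have h1 : ∀ d, Nat.nth p i + d ≤ Nat.nth p (i + d) := by
      intro d
      induction d with
      | zero => simp
      | succ d ih =>
        have := hmono (show i + d < i + (d + 1) by omega)
        omega
    have h2 := h1 (B + 1)
    rw [hnth (i + (B + 1)) (by omega)] at h2
    omega
  obtain ⟨lam, hlam⟩ := exists_rowLen_eq (fun i => B + 1 + i - Nat.nth p i)
    (by
      refine antitone_nat_of_succ_le fun i => ?_
      have := hmono (Nat.lt_succ_self i)
      have := hle i
      have := hle (i + 1)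
      simp only [Nat.succ_eq_add_one] at *
      omega)
    (B + 1) (fun i hi => by
      have := hnth i (by omega)
      omega)
  refine ⟨lam, ?_⟩
  have hval : ∀ i : ℕ, (lam.rowLen i : ℤ) - (i + 1) = (B : ℤ) - Nat.nth p i := by
    intro i
    rw [hlam]
    have := hle i
    omega
  ext x
  simp only [betaSet, Set.mem_range, hval]
  constructor
  · rintro ⟨i, rfl⟩
    have : Nat.nth p i ∈ {k | p k} := hrange ▸ Set.mem_range_self i
    exact this
  · intro hx
    have hxB := hB x hx
    have : (B - x).toNat ∈ {k | p k} := by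
      change (B : ℤ) - (((B : ℤ) - x).toNat : ℤ) ∈ X
      have e : (B : ℤ) - (((B : ℤ) - x).toNat : ℤ) = x := by omega
      rwa [e]
    rw [← hrange] at this
    obtain ⟨i, hi⟩ := this
    exact ⟨i, by rw [hi]; omega⟩

/-! ### Basic facts on `s`-sets of self-conjugate cores -/

theorem betaSet_bddAbove (lam : YoungDiagram) : BddAbove (betaSet lam) := by
  refine ⟨lam.rowLen 0, ?_⟩
  rintro _ ⟨i, rfl⟩
  have := lam.rowLen_anti 0 i (Nat.zero_le _)
  simp only
  omega

theorem sub_mul_mem {s : ℕ} {X : Set ℤ} (h : ∀ b ∈ X, b - s ∈ X) (b : ℤ) (hb : b ∈ X) (k : ℕ) :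
    b - s * k ∈ X := by
  induction k with
  | zero => simpa using hb
  | succ k ih =>
    have := h _ ih
    have e : b - (s : ℤ) * ((k + 1 : ℕ) : ℤ) = b - s * k - s := by push_cast; ring
    rwa [e]

theorem mem_of_modEq {s : ℕ} (hs : 0 < s) {X : Set ℤ} (h : ∀ b ∈ X, b - s ∈ X) {a b : ℤ}
    (hb : b ∈ X) (hab : a ≡ b [ZMOD s]) (hle : a ≤ b) : a ∈ X := by
  obtain ⟨k, hk⟩ := hab.dvd
  have hk0 : 0 ≤ k := by
    by_contra hneg
    have : (s : ℤ) * k < 0 := mul_neg_of_pos_of_neg (by exact_mod_cast hs) (by omega)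
    omega
  have := sub_mul_mem h b hb k.toNat
  rw [Int.toNat_of_nonneg hk0] at this
  have e : b - (s : ℤ) * k = a := by omega
  rwa [e] at this

namespace SelfConjCore

variable {s : ℕ} (lam : SelfConjCore s)

theorem sub_mem (hs : 0 < s) : ∀ b ∈ betaSet lam.1, b - s ∈ betaSet lam.1 :=
  (isCore_iff hs _).1 lam.2

theorem mem_symm (x : ℤ) : x ∈ betaSet lam.1 ↔ -1 - x ∉ betaSet lam.1 :=
  (isSelfConjugate_iff _).1 lam.3 x

theorem mem_sSet_iff (hs : 0 < s) (a : ℤ) :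
    a ∈ sSet s lam.1 ↔ a ∉ betaSet lam.1 ∧ a - s ∈ betaSet lam.1 := by
  constructor
  · rintro ⟨⟨_, h1⟩, h2⟩
    refine ⟨h1, ?_⟩
    by_contra h3
    have : a ≤ a - s := h2 ⟨by simp [Int.ModEq], h3⟩
    omega
  · rintro ⟨h1, h2⟩
    refine ⟨⟨Int.ModEq.refl _, h1⟩, ?_⟩
    rintro b ⟨hb, hb'⟩
    by_contra hlt
    rw [not_le] at hlt
    apply hb'
    refine mem_of_modEq hs (lam.sub_mem hs) h2 (hb.trans (by simp [Int.ModEq])) ?_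
    obtain ⟨k, hk⟩ := hb.dvd
    have hk0 : 1 ≤ k := by
      by_contra hneg
      have : (s : ℤ) * k ≤ 0 :=
        mul_nonpos_of_nonneg_of_nonpos (by exact_mod_cast hs.le) (by omega)
      omega
    have : (s : ℤ) * 1 ≤ s * k := mul_le_mul_of_nonneg_left hk0 (by exact_mod_cast hs.le)
    omega

theorem mem_betaSet_iff (hs : 0 < s) {a m : ℤ} (ha : a ∈ sSet s lam.1) (hm : m ≡ a [ZMOD s]) :
    m ∈ betaSet lam.1 ↔ m < a := by
  have ha' := (lam.mem_sSet_iff hs a).1 ha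
  constructor
  · intro h
    by_contra hle
    exact ha'.1 (mem_of_modEq hs (lam.sub_mem hs) h hm.symm (by omega))
  · intro h
    by_contra hm'
    have := ha.2 ⟨hm, hm'⟩
    omega

theorem sSet_unique (hs : 0 < s) {a b : ℤ} (ha : a ∈ sSet s lam.1) (hb : b ∈ sSet s lam.1)
    (hab : a ≡ b [ZMOD s]) : a = b := by
  have h1 := lam.mem_betaSet_iff hs ha hab.symm
  have h2 := lam.mem_betaSet_iff hs hb hab
  have h3 := ((lam.mem_sSet_iff hs a).1 ha).1
  have h4 := ((lam.mem_sSet_iff hs b).1 hb).1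
  rw [h1] at h4
  rw [h2] at h3
  omega

theorem exists_sSet (hs : 0 < s) (m : ℤ) : ∃ a ∈ sSet s lam.1, m ≡ a [ZMOD s] := by
  obtain ⟨B, hB⟩ := betaSet_bddAbove lam.1
  have hs' : (1 : ℤ) ≤ s := by exact_mod_cast hs
  have hlow : ∀ x : ℤ, x < -1 - B → x ∈ betaSet lam.1 := by
    intro x hx
    rw [lam.mem_symm]
    intro h
    have := hB h
    omega
  obtain ⟨a, ⟨h1, h2⟩, h3⟩ := Int.exists_least_of_bdd
    (P := fun b => b ≡ m [ZMOD s] ∧ b ∉ betaSet lam.1)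
    ⟨-1 - B, fun z hz => by
      by_contra hlt
      exact hz.2 (hlow z (by omega))⟩
    ⟨m + s * (|B| + |m| + 1), by simp [Int.ModEq], fun h => by
      have h1 := hB h
      have h2 : 1 * (|B| + |m| + 1) ≤ s * (|B| + |m| + 1) :=
        mul_le_mul_of_nonneg_right hs' (by positivity)
      have := le_abs_self B
      have := neg_abs_le m
      omega⟩
  exact ⟨a, ⟨⟨Int.ModEq.refl _, h2⟩, fun b hb => h3 b ⟨hb.1.trans h1, hb.2⟩⟩, h1.symm⟩

theorem sSet_symm (hs : 0 < s) {a : ℤ} (ha : a ∈ sSet s lam.1) :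
    (s : ℤ) - 1 - a ∈ sSet s lam.1 := by
  rw [lam.mem_sSet_iff hs] at ha ⊢
  have h1 := lam.mem_symm (a - s)
  have h2 := lam.mem_symm (-1 - a)
  have e1 : -1 - (a - (s : ℤ)) = s - 1 - a := by ring
  have e2 : -1 - (-1 - a) = a := by ring
  have e3 : (s : ℤ) - 1 - a - s = -1 - a := by ring
  rw [e1] at h1
  rw [e2] at h2
  rw [e3]
  exact ⟨h1.1 ha.2, h2.2 ha.1⟩

theorem eq_of_sSet_subset (hs : 0 < s) {lam mu : SelfConjCore s}
    (h : ∀ a ∈ sSet s lam.1, a ∈ sSet s mu.1) : lam = mu := by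
  apply SelfConjCore.ext
  apply betaSet_injective
  ext m
  obtain ⟨a, ha, hm⟩ := lam.exists_sSet hs m
  rw [lam.mem_betaSet_iff hs ha hm, mu.mem_betaSet_iff hs (h a ha) hm]

theorem coreEquiv_iff (hs : 0 < s) (N : ℕ) (lam mu : SelfConjCore s) :
    CoreEquiv s N lam.1 mu.1 ↔ ∀ a ∈ sSet s lam.1, ∀ b ∈ sSet s mu.1,
      a ≡ b [ZMOD s] → a ≡ b [ZMOD ((N : ℤ) * s)] := by
  constructor
  · rintro ⟨φ, hφ⟩ a ha b hb hab
    have h1 := hφ ⟨a, ha⟩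
    have h2 : (φ ⟨a, ha⟩ : ℤ) = b :=
      mu.sSet_unique hs (φ ⟨a, ha⟩).2 hb
        ((h1.of_dvd (Dvd.intro_left _ rfl)).trans hab)
    rw [h2] at h1
    exact h1.symm
  · intro h
    choose f hf using fun a : sSet s lam.1 => mu.exists_sSet hs (a : ℤ)
    refine ⟨Equiv.ofBijective (fun a => ⟨f a, (hf a).1⟩) ⟨?_, ?_⟩, ?_⟩
    · intro a b hab
      have hab' : f a = f b := congrArg Subtype.val hab
      apply Subtype.ext
      refine lam.sSet_unique hs a.2 b.2 ?_
      exact (hf a).2.trans (hab' ▸ (hf b).2.symm)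
    · intro b
      obtain ⟨a, ha, hab⟩ := lam.exists_sSet hs (b : ℤ)
      refine ⟨⟨a, ha⟩, Subtype.ext ?_⟩
      exact mu.sSet_unique hs (hf ⟨a, ha⟩).1 b.2 ((hf ⟨a, ha⟩).2.symm.trans hab.symm)
    · intro a
      exact (h a a.2 _ (hf a).1 (hf a).2).symm

theorem coreEquiv_symm (hs : 0 < s) {N : ℕ} {lam mu : SelfConjCore s}
    (h : CoreEquiv s N lam.1 mu.1) : CoreEquiv s N mu.1 lam.1 := by
  rw [coreEquiv_iff hs] at h ⊢
  exact fun a ha b hb hab => (h b hb a ha hab.symm).symm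

theorem coreEquiv_trans (hs : 0 < s) {N : ℕ} {lam mu nu : SelfConjCore s}
    (h : CoreEquiv s N lam.1 mu.1) (h' : CoreEquiv s N mu.1 nu.1) :
    CoreEquiv s N lam.1 nu.1 := by
  rw [coreEquiv_iff hs] at h h' ⊢
  intro a ha b hb hab
  obtain ⟨c, hc, hac⟩ := mu.exists_sSet hs a
  exact (h a ha c hc hac).trans (h' c hc b hb (hac.symm.trans hab))

theorem two_mul_sub_lt (hs : 0 < s) {N : ℕ} {lam : SelfConjCore s}
    (h : ∀ k ∈ sSet s lam.1, ∀ l ∈ sSet s lam.1, k - l < (N : ℤ) * s) {a : ℤ}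
    (ha : a ∈ sSet s lam.1) :
    2 * a - (s - 1) < (N : ℤ) * s ∧ -((N : ℤ) * s) < 2 * a - (s - 1) := by
  have h1 := h a ha _ (lam.sSet_symm hs ha)
  have h2 := h _ (lam.sSet_symm hs ha) a ha
  constructor <;> linarith

theorem eq_of_coreEquiv (hs : 0 < s) {N : ℕ} {lam mu : SelfConjCore s}
    (hlam : ∀ k ∈ sSet s lam.1, ∀ l ∈ sSet s lam.1, k - l < (N : ℤ) * s)
    (hmu : ∀ k ∈ sSet s mu.1, ∀ l ∈ sSet s mu.1, k - l < (N : ℤ) * s)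
    (h : CoreEquiv s N lam.1 mu.1) : lam = mu := by
  rw [coreEquiv_iff hs] at h
  refine eq_of_sSet_subset hs fun a ha => ?_
  obtain ⟨b, hb, hab⟩ := mu.exists_sSet hs a
  have h1 := two_mul_sub_lt hs hlam ha
  have h2 := two_mul_sub_lt hs hmu hb
  have h3 : b - a = 0 := by
    refine Int.eq_zero_of_abs_lt_dvd (h a ha b hb hab).dvd ?_
    rw [abs_lt]
    constructor <;> linarith
  have h4 : a = b := by omega
  rwa [h4]

/-- Every class of self-conjugate `s`-cores under `≡_N` contains a core of bounded spread. -/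
theorem exists_bounded (hs : 0 < s) {N : ℕ} (hN : 0 < N) (lam : SelfConjCore s) :
    ∃ mu : BoundedSelfConjCore s N, CoreEquiv s N lam.1 mu.1.1 := by
  have hs' : (0 : ℤ) < s := by exact_mod_cast hs
  have hN' : (0 : ℤ) < N := by exact_mod_cast hN
  have hNs : (0 : ℤ) < (N : ℤ) * s := mul_pos hN' hs'
  set P : ℤ := (N : ℤ) * s with hP
  let f : ℤ → ℤ := fun a => a - P * ((2 * a - (s - 1) + P) / (2 * P))
  have fmod : ∀ a, f a ≡ a [ZMOD P] := fun a => by simp [f, Int.ModEq]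
  have fmods : ∀ a, f a ≡ a [ZMOD s] := fun a => (fmod a).of_dvd (Dvd.intro_left _ rfl)
  have flt : ∀ a, 2 * f a - (s - 1) < P := by
    intro a
    have h1 := Int.emod_add_mul_ediv (2 * a - (s - 1) + P) (2 * P)
    have h2 := Int.emod_lt_of_pos (2 * a - (s - 1) + P) (show 0 < 2 * P by omega)
    simp only [f]
    linarith
  have fge : ∀ a, -P ≤ 2 * f a - (s - 1) := by
    intro a
    have h1 := Int.emod_add_mul_ediv (2 * a - (s - 1) + P) (2 * P)
    have h2 := Int.emod_nonneg (2 * a - (s - 1) + P) (show 2 * P ≠ 0 by omega)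
    simp only [f]
    linarith
  have fgt : ∀ a ∈ sSet s lam.1, -P < 2 * f a - (s - 1) := by
    intro a ha
    refine lt_of_le_of_ne (fge a) fun heq => ?_
    have h1 : a ≡ s - 1 - a [ZMOD s] := by
      have h2 : f a ≡ s - 1 - f a [ZMOD s] := by
        rw [Int.modEq_iff_dvd]
        exact ⟨N, by rw [hP] at heq; linarith⟩
      exact (fmods a).symm.trans (h2.trans ((Int.ModEq.refl _).sub (fmods a)))
    have h3 := lam.sSet_unique hs ha (lam.sSet_symm hs ha) h1
    obtain ⟨k, hk⟩ := (fmod a).dvd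
    have h5 : P * (2 * k) = P * 1 := by linarith
    have h6 := mul_left_cancel₀ hNs.ne' h5
    omega
  have fsymm : ∀ a ∈ sSet s lam.1, f (s - 1 - a) = s - 1 - f a := by
    intro a ha
    have h1 := flt (s - 1 - a)
    have h2 := fgt _ (lam.sSet_symm hs ha)
    have h3 := flt a
    have h4 := fgt a ha
    have h5 : f (s - 1 - a) ≡ s - 1 - f a [ZMOD P] :=
      (fmod _).trans ((Int.ModEq.refl _).sub (fmod a).symm)
    have h6 : s - 1 - f a - f (s - 1 - a) = 0 := by
      refine Int.eq_zero_of_abs_lt_dvd h5.dvd ?_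
      rw [abs_lt]
      constructor <;> linarith
    omega
  let X : Set ℤ := {m | ∃ a ∈ sSet s lam.1, m ≡ a [ZMOD s] ∧ m < f a}
  have hX : ∀ {m a : ℤ}, a ∈ sSet s lam.1 → m ≡ a [ZMOD s] → (m ∈ X ↔ m < f a) := by
    intro m a ha hm
    constructor
    · rintro ⟨b, hb, hmb, hlt⟩
      rwa [lam.sSet_unique hs ha hb (hm.symm.trans hmb)]
    · exact fun h => ⟨a, ha, hm, h⟩
  have hXsub : ∀ b ∈ X, b - s ∈ X := by
    rintro b ⟨a, ha, hm, hlt⟩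
    exact ⟨a, ha, Int.ModEq.trans (by simp [Int.ModEq]) hm, by omega⟩
  have hXsymm : ∀ m, m ∈ X ↔ -1 - m ∉ X := by
    intro m
    obtain ⟨a, ha, hm⟩ := lam.exists_sSet hs m
    have hm' : -1 - m ≡ s - 1 - a [ZMOD s] := by
      have := (Int.ModEq.refl (n := (s : ℤ)) (-1)).sub hm
      refine this.trans ?_
      rw [Int.modEq_iff_dvd]
      exact ⟨1, by ring⟩
    rw [hX ha hm, hX (lam.sSet_symm hs ha) hm', fsymm a ha]
    obtain ⟨k, hk⟩ := ((fmods a).trans hm.symm).dvd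
    constructor
    · intro h1 h2
      have h3 : (s : ℤ) * k < s * 0 := by linarith
      have h4 : (s : ℤ) * (-1) < s * k := by linarith
      have := lt_of_mul_lt_mul_left h3 hs'.le
      have := lt_of_mul_lt_mul_left h4 hs'.le
      omega
    · intro h1
      omega
  have hXbdd : BddAbove X := by
    refine ⟨P + s, ?_⟩
    rintro m ⟨a, _, _, hlt⟩
    have := flt a
    linarith
  obtain ⟨mu0, hmu0⟩ := exists_betaSet_eq X hXsymm hXbdd
  let mu : SelfConjCore s := ⟨mu0, (isCore_iff hs _).2 (by rw [hmu0]; exact hXsub),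
    (isSelfConjugate_iff _).2 (by rw [hmu0]; exact hXsymm)⟩
  have hmu : betaSet mu.1 = X := hmu0
  have hfmem : ∀ a ∈ sSet s lam.1, f a ∈ sSet s mu.1 := by
    intro a ha
    rw [mu.mem_sSet_iff hs, hmu, hX ha (fmods a),
      hX ha (Int.ModEq.trans (by simp [Int.ModEq]) (fmods a))]
    omega
  have hfsurj : ∀ b ∈ sSet s mu.1, ∃ a ∈ sSet s lam.1, b = f a := by
    intro b hb
    obtain ⟨a, ha, hab⟩ := lam.exists_sSet hs b
    exact ⟨a, ha, mu.sSet_unique hs hb (hfmem a ha) (hab.trans (fmods a).symm)⟩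
  refine ⟨⟨mu, ?_⟩, ?_⟩
  · intro k hk l hl
    obtain ⟨a, ha, rfl⟩ := hfsurj k hk
    obtain ⟨b, hb, rfl⟩ := hfsurj l hl
    have := flt a
    have := fgt b hb
    linarith
  · rw [coreEquiv_iff hs]
    intro a ha b hb hab
    obtain ⟨c, hc, rfl⟩ := hfsurj b hb
    have : a = c := lam.sSet_unique hs ha hc (hab.trans (fmods c))
    subst this
    exact (fmod a).symm

end SelfConjCore

/-! ### The affine symmetric group and the affine hyperoctahedral group -/

theorem periodic_add_mul {s : ℕ} {w : ℤ → ℤ} (hw : ∀ m, w (m + s) = w m + s) (m k : ℤ) :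
    w (m + s * k) = w m + s * k := by
  induction k using Int.induction_on with
  | zero => simp
  | succ k ih =>
    have := hw (m + s * k)
    rw [ih] at this
    rw [show m + (s : ℤ) * ((k : ℤ) + 1) = m + s * k + s by ring, this]
    ring
  | pred k ih =>
    have := hw (m + s * (-(k : ℤ) - 1))
    rw [show m + (s : ℤ) * (-(k : ℤ) - 1) + s = m + s * (-(k : ℤ)) by ring, ih] at this
    linarith

theorem periodic_inv {s : ℕ} {w : Equiv.Perm ℤ} (hw : ∀ m, w (m + s) = w m + s) (m : ℤ) :
    w⁻¹ (m + s) = w⁻¹ m + s := by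
  apply w.injective
  rw [hw]
  simp

theorem periodic_modEq {s : ℕ} {w : ℤ → ℤ} (hw : ∀ m, w (m + s) = w m + s) {N m m' : ℤ}
    (h : m ≡ m' [ZMOD (N * s)]) : w m ≡ w m' [ZMOD (N * s)] := by
  obtain ⟨k, hk⟩ := h.dvd
  have e : m' = m + s * (N * k) := by linarith
  rw [e, periodic_add_mul hw, Int.modEq_iff_dvd]
  exact ⟨k, by ring⟩

theorem sum_comp_periodic {s : ℕ} (w : Equiv.Perm ℤ) (hw : ∀ m, w (m + s) = w m + s)
    (f : ℤ → ℤ) (hf : ∀ m k : ℤ, f (m + s * k) = f m) :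
    ∑ m ∈ Finset.range s, f (w m) = ∑ m ∈ Finset.range s, f m := by
  rcases Nat.eq_zero_or_pos s with rfl | hs
  · simp
  have hs' : (0 : ℤ) < s := by exact_mod_cast hs
  have hfm : ∀ m : ℤ, f (m % s) = f m := fun m => by
    have := hf (m % s) (m / s)
    rwa [Int.emod_add_mul_ediv, eq_comm] at this
  have step : ∀ v : Equiv.Perm ℤ, (∀ m, v (m + s) = v m + s) → ∀ m : ℤ,
      v (m % s) % s = v m % s := by
    intro v hv m
    have := periodic_add_mul hv (m % s) (m / s)
    rw [Int.emod_add_mul_ediv] at this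
    rw [this]
    simp
  have cast : ∀ m : ℤ, ((m % s).toNat : ℤ) = m % s := fun m =>
    Int.toNat_of_nonneg (Int.emod_nonneg _ hs'.ne')
  have mem : ∀ m : ℤ, (m % s).toNat ∈ Finset.range s := fun m => by
    have := Int.emod_lt_of_pos m hs'
    have := cast m
    rw [Finset.mem_range]
    omega
  refine Finset.sum_bij' (fun m _ => (w m % s).toNat) (fun m _ => (w⁻¹ m % s).toNat)
    (fun m _ => mem _) (fun m _ => mem _) ?_ ?_ ?_
  · intro m hm
    rw [Finset.mem_range] at hm
    rw [cast, step w⁻¹ (periodic_inv hw)]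
    rw [Equiv.Perm.inv_def, Equiv.symm_apply_apply]
    rw [Int.emod_eq_of_lt (by omega) (by omega)]
    simp
  · intro m hm
    rw [Finset.mem_range] at hm
    rw [cast, step w hw]
    rw [Equiv.Perm.inv_def, Equiv.apply_symm_apply]
    rw [Int.emod_eq_of_lt (by omega) (by omega)]
    simp
  · intro m _
    rw [cast, hfm]

theorem sum_range_cast (s : ℕ) :
    ∑ m ∈ Finset.range s, (m : ℤ) = (s.choose 2 : ℤ) := by
  rw [Nat.choose_two_right, ← Finset.sum_range_id]
  push_cast
  rfl

/-- The affine symmetric group of degree `s`: the permutations `w` of `ℤ` with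
`w (m + s) = w m + s` for all `m` and `w 0 + ⋯ + w (s - 1) = s.choose 2`. -/
def AffineSymm (s : ℕ) : Subgroup (Equiv.Perm ℤ) where
  carrier := {w | (∀ m, w (m + s) = w m + s) ∧
    ∑ m ∈ Finset.range s, w (m : ℤ) = (s.choose 2 : ℤ)}
  one_mem' := by
    refine ⟨fun m => rfl, ?_⟩
    exact sum_range_cast s
  mul_mem' := by
    rintro v w ⟨hv1, hv2⟩ ⟨hw1, hw2⟩
    refine ⟨fun m => by rw [Equiv.Perm.mul_apply, hw1, hv1, Equiv.Perm.mul_apply], ?_⟩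
    have key := sum_comp_periodic w hw1 (fun m => v m - m)
      (fun m k => by rw [periodic_add_mul hv1]; ring)
    have hid := sum_range_cast s
    simp only [Finset.sum_sub_distrib] at key
    simp only [Equiv.Perm.mul_apply]
    linarith
  inv_mem' := by
    rintro w ⟨hw1, hw2⟩
    refine ⟨periodic_inv hw1, ?_⟩
    have key := sum_comp_periodic w hw1 (fun m => w⁻¹ m - m)
      (fun m k => by rw [periodic_add_mul (periodic_inv hw1)]; ring)
    simp only [Finset.sum_sub_distrib, Equiv.Perm.inv_def, Equiv.symm_apply_apply] at key
    have hid := sum_range_cast s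
    simp only [Equiv.Perm.inv_def]
    linarith

theorem AffineSymm.periodic {s : ℕ} (w : AffineSymm s) (m : ℤ) :
    (w : Equiv.Perm ℤ) (m + s) = (w : Equiv.Perm ℤ) m + s := w.2.1 m

/-- The function `m ↦ m + 1` on the class `i - 1`, `m ↦ m - 1` on the class `i`, and the identity
on the other classes modulo `s`. -/
def genWFun {s : ℕ} (i : ZMod s) (m : ℤ) : ℤ :=
  if (m : ZMod s) = i - 1 then m + 1 else if (m : ZMod s) = i then m - 1 else m

theorem zmod_one_ne_zero {s : ℕ} (hs : 2 ≤ s) : (1 : ZMod s) ≠ 0 := by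
  have : Fact (1 < s) := ⟨hs⟩
  exact one_ne_zero

theorem sub_one_ne {s : ℕ} (h1 : (1 : ZMod s) ≠ 0) (i : ZMod s) : i - 1 ≠ i := fun h =>
  h1 (by linear_combination -h)

theorem genWFun_spec {s : ℕ} (h1 : (1 : ZMod s) ≠ 0) (i : ZMod s) (m : ℤ) :
    ((m : ZMod s) = i - 1 ∧ genWFun i m = m + 1 ∧ ((genWFun i m : ℤ) : ZMod s) = i) ∨
    ((m : ZMod s) = i ∧ genWFun i m = m - 1 ∧ ((genWFun i m : ℤ) : ZMod s) = i - 1) ∨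
    ((m : ZMod s) ≠ i ∧ (m : ZMod s) ≠ i - 1 ∧ genWFun i m = m) := by
  have hi := (sub_one_ne h1 i).symm
  by_cases ha : (m : ZMod s) = i - 1
  · left
    simp [genWFun, ha]
  · right
    by_cases hb : (m : ZMod s) = i
    · left
      simp [genWFun, hb, hi]
    · right
      simp [genWFun, ha, hb]

theorem genWFun_involutive {s : ℕ} (hs : 2 ≤ s) (i : ZMod s) :
    Function.Involutive (genWFun i) := by
  have h1 := zmod_one_ne_zero hs
  have hi := sub_one_ne h1 i
  intro m
  rcases genWFun_spec h1 i m with h | h | h <;>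
  rcases genWFun_spec h1 i (genWFun i m) with h' | h' | h' <;> grind

theorem genWFun_periodic {s : ℕ} (i : ZMod s) (m : ℤ) :
    genWFun i (m + s) = genWFun i m + s := by
  simp only [genWFun, Int.cast_add, Int.cast_natCast, CharP.cast_eq_zero, add_zero]
  split_ifs <;> ring

/-- The generator `w_i` of the affine symmetric group. -/
def genW {s : ℕ} (hs : 2 ≤ s) (i : ZMod s) : AffineSymm s :=
  ⟨(genWFun_involutive hs i).toPerm, genWFun_periodic i, by
    have key := sum_comp_periodic (genWFun_involutive hs i).toPerm (genWFun_periodic i)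
      (fun m => genWFun i m - m)
      (fun m k => by rw [periodic_add_mul (genWFun_periodic i)]; ring)
    have hinv : ∀ m, genWFun i (genWFun i m) = m := genWFun_involutive hs i
    have hid := sum_range_cast s
    simp only [Finset.sum_sub_distrib, Function.Involutive.coe_toPerm,
      hinv] at key
    simp only [Function.Involutive.coe_toPerm]
    linarith⟩

/-- With `u = ⌊s / 2⌋`: `v_i = w_i` if `i = 0`, `v_i = w_i w_{-i} w_i` if `i = u` or `i = -u`,
and `v_i = w_i w_{-i}` for the other classes `i` modulo `s`. -/
def genV {s : ℕ} (hs : 2 ≤ s) (i : ZMod s) : AffineSymm s :=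
  if i = 0 then genW hs i
  else if i = ((s / 2 : ℕ) : ZMod s) ∨ i = -((s / 2 : ℕ) : ZMod s) then
    genW hs i * genW hs (-i) * genW hs i
  else genW hs i * genW hs (-i)

/-- The affine hyperoctahedral group, as the subgroup of the affine symmetric group generated
by the elements `v_i`. -/
def AffineHyp {s : ℕ} (hs : 2 ≤ s) : Subgroup (AffineSymm s) :=
  Subgroup.closure (Set.range (genV hs))

theorem genWFun_symm {s : ℕ} (hs : 2 ≤ s) (i : ZMod s) (m : ℤ) :
    genWFun i (-1 - m) = -1 - genWFun (-i) m := by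
  have h1 := zmod_one_ne_zero hs
  have hi := sub_one_ne h1 (-i)
  have e1 : ((-1 - m : ℤ) : ZMod s) = i - 1 ↔ (m : ZMod s) = -i := by
    push_cast
    constructor <;> intro h <;> linear_combination -h
  have e2 : ((-1 - m : ℤ) : ZMod s) = i ↔ (m : ZMod s) = -i - 1 := by
    push_cast
    constructor <;> intro h <;> linear_combination -h
  simp only [genWFun, e1, e2]
  split_ifs with ha hb hb
  · exact absurd (hb.symm.trans ha) hi
  all_goals ring

theorem genWFun_comm {s : ℕ} (i j : ZMod s) (h1 : (1 : ZMod s) ≠ 0) (h2 : i ≠ j)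
    (h3 : i ≠ j + 1) (h4 : j ≠ i + 1) (m : ℤ) :
    genWFun i (genWFun j m) = genWFun j (genWFun i m) := by
  have d1 : i - 1 ≠ j := fun h => h3 (by linear_combination h)
  have d2 : j - 1 ≠ i := fun h => h4 (by linear_combination h)
  have d3 : i - 1 ≠ j - 1 := fun h => h2 (by linear_combination h)
  rcases genWFun_spec h1 i m with h | h | h <;>
  rcases genWFun_spec h1 j m with h' | h' | h' <;>
  rcases genWFun_spec h1 i (genWFun j m) with k | k | k <;>
  rcases genWFun_spec h1 j (genWFun i m) with k' | k' | k' <;> grind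

theorem genWFun_braid {s : ℕ} (i : ZMod s) (h1 : (1 : ZMod s) ≠ 0) (h2 : (2 : ZMod s) ≠ 0)
    (m : ℤ) :
    genWFun i (genWFun (i + 1) (genWFun i m))
      = genWFun (i + 1) (genWFun i (genWFun (i + 1) m)) := by
  have d1 : i - 1 ≠ i := sub_one_ne h1 i
  have d2 : i + 1 ≠ i := fun h => h1 (by linear_combination h)
  have d3 : i + 1 ≠ i - 1 := fun h => h2 (by linear_combination h)
  have up : ∀ (x : ZMod s) (k : ℤ), (k : ZMod s) = x → ((k + 1 : ℤ) : ZMod s) = x + 1 :=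
    fun x k h => by push_cast; rw [h]
  have dn : ∀ (x : ZMod s) (k : ℤ), (k : ZMod s) = x → ((k - 1 : ℤ) : ZMod s) = x - 1 :=
    fun x k h => by push_cast; rw [h]
  have a1 : ∀ k : ℤ, (k : ZMod s) = i - 1 → genWFun i k = k + 1 := fun k h => by
    simp [genWFun, h]
  have a2 : ∀ k : ℤ, (k : ZMod s) = i → genWFun i k = k - 1 := fun k h => by
    simp [genWFun, h, d1.symm]
  have a3 : ∀ k : ℤ, (k : ZMod s) ≠ i - 1 → (k : ZMod s) ≠ i → genWFun i k = k :=
    fun k h h' => by simp [genWFun, h, h']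
  have b1 : ∀ k : ℤ, (k : ZMod s) = i → genWFun (i + 1) k = k + 1 := fun k h => by
    simp [genWFun, h]
  have b2 : ∀ k : ℤ, (k : ZMod s) = i + 1 → genWFun (i + 1) k = k - 1 := fun k h => by
    simp [genWFun, h, h1]
  have b3 : ∀ k : ℤ, (k : ZMod s) ≠ i → (k : ZMod s) ≠ i + 1 → genWFun (i + 1) k = k :=
    fun k h h' => by simp [genWFun, h, h']
  by_cases hm1 : (m : ZMod s) = i - 1
  · have e1 : ((m + 1 : ℤ) : ZMod s) = i := by rw [up _ _ hm1]; ring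
    have e2 : ((m + 1 + 1 : ℤ) : ZMod s) = i + 1 := up _ _ e1
    rw [a1 m hm1, b1 _ e1, a3 _ (by rw [e2]; exact d3) (by rw [e2]; exact d2),
      b3 m (by rw [hm1]; exact d1) (by rw [hm1]; exact d3.symm), a1 m hm1, b1 _ e1]
  by_cases hm2 : (m : ZMod s) = i
  · have e1 : ((m - 1 : ℤ) : ZMod s) = i - 1 := dn _ _ hm2
    have e2 : ((m + 1 : ℤ) : ZMod s) = i + 1 := up _ _ hm2
    rw [a2 m hm2, b3 _ (by rw [e1]; exact d1) (by rw [e1]; exact d3.symm), a1 _ e1, b1 m hm2,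
      a3 _ (by rw [e2]; exact d3) (by rw [e2]; exact d2), b2 _ e2]
    ring
  by_cases hm3 : (m : ZMod s) = i + 1
  · have e1 : ((m - 1 : ℤ) : ZMod s) = i := by rw [dn _ _ hm3]; ring
    have e2 : ((m - 1 - 1 : ℤ) : ZMod s) = i - 1 := dn _ _ e1
    rw [a3 m hm1 hm2, b2 m hm3, a2 _ e1,
      b3 _ (by rw [e2]; exact d1) (by rw [e2]; exact d3.symm)]
  · rw [a3 m hm1 hm2, b3 m hm2 hm3, a3 m hm1 hm2, b3 m hm2 hm3]

/-- In `ℤ / s`, the classes `i` for which `w_i` and `w_{-i}` may fail to commute are `0`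
and the classes of `u` and `-u`. -/
theorem zmod_class_cases {s : ℕ} (hs : 2 ≤ s) (i : ZMod s) (h0 : i ≠ 0)
    (hu : i ≠ ((s / 2 : ℕ) : ZMod s)) (hu' : i ≠ -((s / 2 : ℕ) : ZMod s)) :
    i ≠ -i ∧ i ≠ -i + 1 ∧ -i ≠ i + 1 := by
  have : NeZero s := ⟨by omega⟩
  have hk := ZMod.val_lt i
  set k := i.val with hkdef
  have hi : i = ((k : ℤ) : ZMod s) := by
    rw [hkdef]
    simp
  have z : ∀ x : ℤ, (x : ZMod s) = 0 ↔ (s : ℤ) ∣ x := fun x =>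
    ZMod.intCast_zmod_eq_zero_iff_dvd x s
  have g0 : k ≠ 0 := fun h => h0 (by rw [hi, h]; simp)
  have gu : k ≠ s / 2 := fun h => hu (by rw [hi, h, Int.cast_natCast])
  have gu' : k ≠ s - s / 2 := fun h => hu' (by
    rw [hi, h, Int.cast_natCast, Nat.cast_sub (by omega)]
    simp)
  have small : ∀ x : ℤ, -(s : ℤ) < x → x < 2 * s → (s : ℤ) ∣ x → x = 0 ∨ x = s := by
    rintro x hx1 hx2 ⟨c, rfl⟩
    have hs' : (0 : ℤ) < s := by omega
    have c1 : -1 < c := by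
      by_contra hc
      have := mul_le_mul_of_nonneg_left (show c ≤ -1 by omega) hs'.le
      omega
    have c2 : c < 2 := by
      by_contra hc
      have := mul_le_mul_of_nonneg_left (show 2 ≤ c by omega) hs'.le
      omega
    have : c = 0 ∨ c = 1 := by omega
    rcases this with rfl | rfl <;> simp
  refine ⟨fun h => ?_, fun h => ?_, fun h => ?_⟩
  · have := (z (2 * k)).1 (by push_cast; rw [hi] at h; push_cast at h; linear_combination h)
    have := small _ (by omega) (by omega) this
    omega
  · have := (z (2 * k - 1)).1 (by push_cast; rw [hi] at h; push_cast at h; linear_combination h)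
    have := small _ (by omega) (by omega) this
    omega
  · have := (z (2 * k + 1)).1 (by push_cast; rw [hi] at h; push_cast at h; linear_combination -h)
    have := small _ (by omega) (by omega) this
    omega

theorem genV_symm {s : ℕ} (hs : 2 ≤ s) (i : ZMod s) (m : ℤ) :
    (genV hs i : Equiv.Perm ℤ) (-1 - m) = -1 - (genV hs i : Equiv.Perm ℤ) m := by
  have h1 := zmod_one_ne_zero hs
  have gw : ∀ (j : ZMod s) (k : ℤ), (genW hs j : Equiv.Perm ℤ) k = genWFun j k :=
    fun j k => rfl
  unfold genV
  split_ifs with h0 hu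
  · subst h0
    rw [gw, gw, genWFun_symm hs, neg_zero]
  · simp only [Subgroup.coe_mul, Equiv.Perm.mul_apply, gw, genWFun_symm hs, neg_neg]
    congr 1
    rcases Nat.even_or_odd' s with ⟨r, hr | hr⟩
    · have hii : -i = i := by
        have hr2 : ((s / 2 : ℕ) : ZMod s) + ((s / 2 : ℕ) : ZMod s) = 0 := by
          rw [← Nat.cast_add, show s / 2 + s / 2 = s by omega]
          simp
        rcases hu with rfl | rfl
        · linear_combination -hr2
        · linear_combination hr2
      rw [hii]
    · have h2 : (2 : ZMod s) ≠ 0 := by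
        intro h
        have h' : ((2 : ℕ) : ZMod s) = 0 := by exact_mod_cast h
        rw [ZMod.natCast_eq_zero_iff] at h'
        have := Nat.le_of_dvd (by norm_num) h'
        omega
      have hr2 : ((s / 2 : ℕ) : ZMod s) + ((s / 2 : ℕ) : ZMod s) + 1 = 0 := by
        have : ((s / 2 + s / 2 + 1 : ℕ) : ZMod s) = 0 := by
          rw [show s / 2 + s / 2 + 1 = s by omega]
          simp
        exact_mod_cast this
      rcases hu with rfl | rfl
      · have e : -((s / 2 : ℕ) : ZMod s) = ((s / 2 : ℕ) : ZMod s) + 1 := by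
          linear_combination -hr2
        rw [e]
        exact (genWFun_braid _ h1 h2 m).symm
      · have e : -((s / 2 : ℕ) : ZMod s) = ((s / 2 : ℕ) : ZMod s) + 1 := by
          linear_combination -hr2
        rw [neg_neg, e]
        exact genWFun_braid _ h1 h2 m
  · simp only [Subgroup.coe_mul, Equiv.Perm.mul_apply, gw, genWFun_symm hs, neg_neg]
    congr 1
    rw [not_or] at hu
    obtain ⟨c1, c2, c3⟩ := zmod_class_cases hs i h0 hu.1 hu.2
    exact (genWFun_comm i (-i) h1 c1 c2 c3 m).symm

theorem AffineHyp.symm {s : ℕ} {hs : 2 ≤ s} (w : AffineHyp hs) (m : ℤ) :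
    (w.1 : Equiv.Perm ℤ) (-1 - m) = -1 - (w.1 : Equiv.Perm ℤ) m := by
  obtain ⟨w, hw⟩ := w
  change (w : Equiv.Perm ℤ) (-1 - m) = -1 - (w : Equiv.Perm ℤ) m
  induction hw using Subgroup.closure_induction generalizing m with
  | mem x hx =>
    obtain ⟨i, rfl⟩ := hx
    exact genV_symm hs i m
  | one => rfl
  | mul x y _ _ hx hy =>
    simp only [Subgroup.coe_mul, Equiv.Perm.mul_apply, hx, hy]
  | inv x _ hx =>
    apply (x : Equiv.Perm ℤ).injective
    rw [hx]
    simp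

/-! ### The level `t` action on `ℤ` -/

/-- The integer `½ (s - 1) (t - 1)`. -/
def levelShift (s t : ℕ) : ℤ := ((s : ℤ) - 1) * ((t : ℤ) - 1) / 2

theorem two_mul_levelShift {s t : ℕ} (hst : s.Coprime t) :
    2 * levelShift s t = ((s : ℤ) - 1) * ((t : ℤ) - 1) := by
  unfold levelShift
  refine Int.mul_ediv_cancel' ?_
  rcases Nat.even_or_odd s with h | h
  · have ht : Odd t := by
      rw [← Nat.not_even_iff_odd]
      intro ht
      have := Nat.dvd_gcd h.two_dvd ht.two_dvd
      rw [hst] at this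
      omega
    obtain ⟨r, hr⟩ := ht
    exact ⟨((s : ℤ) - 1) * r, by rw [hr]; push_cast; ring⟩
  · obtain ⟨r, hr⟩ := h
    exact ⟨r * ((t : ℤ) - 1), by rw [hr]; push_cast; ring⟩

/-- An integer `i` with `i t ≡ m + ½ (s - 1) (t - 1)` modulo `s`. -/
def levelIdx (s t : ℕ) (m : ℤ) : ℤ := (m + levelShift s t) * Nat.gcdA t s

theorem levelIdx_spec {s t : ℕ} (hst : s.Coprime t) (m : ℤ) :
    levelIdx s t m * t ≡ m + levelShift s t [ZMOD s] := by
  have h := Nat.gcd_eq_gcd_ab t s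
  rw [hst.symm] at h
  push_cast at h
  rw [Int.modEq_iff_dvd]
  refine ⟨(m + levelShift s t) * Nat.gcdB t s, ?_⟩
  unfold levelIdx
  linear_combination (m + levelShift s t) * h

theorem idx_unique {s t : ℕ} (hst : s.Coprime t) {i j : ℤ} (h : i * t ≡ j * t [ZMOD s]) :
    i ≡ j [ZMOD s] := by
  refine Int.ModEq.symm ((Int.modEq_iff_dvd).2 ?_)
  have h' := h.symm.dvd
  rw [← sub_mul] at h'
  refine IsCoprime.dvd_of_dvd_mul_right ?_ h'
  exact Nat.isCoprime_iff_coprime.2 hst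

/-- The map `m ↦ m + t (w i - i)`, where `i t ≡ m + ½ (s - 1) (t - 1)` modulo `s`. -/
def levelFun {s : ℕ} (t : ℕ) (w : AffineSymm s) (m : ℤ) : ℤ :=
  m + t * ((w : Equiv.Perm ℤ) (levelIdx s t m) - levelIdx s t m)

theorem levelFun_eq {s t : ℕ} (hst : s.Coprime t) (w : AffineSymm s) {m i : ℤ}
    (hi : i * t ≡ m + levelShift s t [ZMOD s]) :
    levelFun t w m = m + t * ((w : Equiv.Perm ℤ) i - i) := by
  obtain ⟨k, hk⟩ := (idx_unique hst ((levelIdx_spec hst m).trans hi.symm)).dvd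
  have e : i = levelIdx s t m + s * k := by omega
  rw [e, periodic_add_mul (AffineSymm.periodic w), levelFun]
  ring

/-- The level `t` action of the affine symmetric group on `ℤ`. It is characterised on the
generators `w_i` by `levelHom_genW`. -/
def levelHom {s t : ℕ} (hst : s.Coprime t) : AffineSymm s →* Equiv.Perm ℤ :=
  MonoidHom.toHomPerm
    { toFun := fun w => levelFun t w
      map_one' := by
        funext m
        change levelFun t 1 m = m
        simp [levelFun]
      map_mul' := fun v w => by
        funext m
        have hi : (w : Equiv.Perm ℤ) (levelIdx s t m) * t
            ≡ levelFun t w m + levelShift s t [ZMOD s] := by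
          have h := levelIdx_spec hst m
          rw [Int.modEq_iff_dvd] at h ⊢
          convert! h using 1
          rw [levelFun]
          ring
        change levelFun t (v * w) m = levelFun t v (levelFun t w m)
        rw [levelFun_eq hst v hi]
        simp only [levelFun, Subgroup.coe_mul, Equiv.Perm.mul_apply]
        ring }

theorem levelHom_apply {s t : ℕ} (hst : s.Coprime t) (w : AffineSymm s) {m i : ℤ}
    (hi : i * t ≡ m + levelShift s t [ZMOD s]) :
    levelHom hst w m = m + t * ((w : Equiv.Perm ℤ) i - i) :=
  levelFun_eq hst w hi

/-- On generators, the level `t` action is given by `m ↦ m + t` on the class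
`(i - 1) t - ½ (s - 1) (t - 1)`, by `m ↦ m - t` on the class `i t - ½ (s - 1) (t - 1)`,
and by the identity on the other classes modulo `s`. -/
theorem levelHom_genW {s t : ℕ} (hs : 2 ≤ s) (hst : s.Coprime t) (i : ZMod s) (m : ℤ) :
    levelHom hst (genW hs i) m =
      if (m : ZMod s) = (i - 1) * t - (levelShift s t : ℤ) then m + t
      else if (m : ZMod s) = i * t - (levelShift s t : ℤ) then m - t
      else m := by
  have h := levelIdx_spec hst m
  rw [levelHom_apply hst _ h]
  have h' := (ZMod.intCast_eq_intCast_iff _ _ s).2 h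
  push_cast at h'
  have hu : IsUnit (t : ZMod s) := (ZMod.isUnit_iff_coprime t s).2 hst.symm
  have key : ∀ j : ZMod s, ((levelIdx s t m : ℤ) : ZMod s) = j ↔
      (m : ZMod s) = j * t - (levelShift s t : ℤ) := by
    intro j
    rw [← hu.mul_left_inj, h']
    constructor <;> intro e <;> linear_combination e
  change m + t * (genWFun i (levelIdx s t m) - levelIdx s t m) = _
  simp only [genWFun, key]
  split_ifs <;> ring

theorem levelHom_periodic {s t : ℕ} (hst : s.Coprime t) (w : AffineSymm s) (m : ℤ) :
    levelHom hst w (m + s) = levelHom hst w m + s := by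
  have h := levelIdx_spec hst m
  have h' : levelIdx s t m * t ≡ (m + s) + levelShift s t [ZMOD s] := by
    refine h.trans ?_
    rw [Int.modEq_iff_dvd]
    exact ⟨1, by ring⟩
  rw [levelHom_apply hst w h, levelHom_apply hst w h']
  ring

theorem levelHom_symm {s t : ℕ} (hs : 2 ≤ s) (hst : s.Coprime t) (w : AffineHyp hs) (m : ℤ) :
    levelHom hst w.1 (-1 - m) = -1 - levelHom hst w.1 m := by
  have h := levelIdx_spec hst m
  have h' : (-1 - levelIdx s t m) * t ≡ (-1 - m) + levelShift s t [ZMOD s] := by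
    have h2 := two_mul_levelShift hst
    obtain ⟨k, hk⟩ := h.dvd
    rw [Int.modEq_iff_dvd]
    exact ⟨t - 1 - k, by linear_combination h2 - hk⟩
  rw [levelHom_apply hst w.1 h, levelHom_apply hst w.1 h', AffineHyp.symm]
  ring

theorem levelHom_le {s t : ℕ} (hs : 0 < s) (hst : s.Coprime t) (w : AffineSymm s) :
    ∃ D : ℤ, ∀ m, levelHom hst w m ≤ m + D := by
  refine ⟨∑ k ∈ Finset.range s, |levelHom hst w k - k|, fun m => ?_⟩
  have hs' : (0 : ℤ) < s := by exact_mod_cast hs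
  have h0 := Int.emod_nonneg m hs'.ne'
  have h1 := Int.emod_lt_of_pos m hs'
  have h2 := periodic_add_mul (levelHom_periodic hst w) (m % s) (m / s)
  rw [Int.emod_add_mul_ediv] at h2
  have h3 := Int.emod_add_mul_ediv m s
  have h4 := Finset.single_le_sum (f := fun k : ℕ => |levelHom hst w k - k|)
    (fun k _ => abs_nonneg _) (Finset.mem_range.2 (show (m % s).toNat < s by omega))
  simp only [Int.toNat_of_nonneg h0] at h4
  have h5 := le_abs_self (levelHom hst w (m % s) - m % s)
  linarith

/-! ### The level `t` actions of the affine hyperoctahedral group on self-conjugate cores -/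

theorem exists_levelAction {s t : ℕ} (hs : 2 ≤ s) (hst : s.Coprime t) (w : AffineHyp hs)
    (lam : SelfConjCore s) :
    ∃ mu : SelfConjCore s, betaSet mu.1 = levelHom hst w.1 '' betaSet lam.1 := by
  have hs0 : 0 < s := by omega
  have himg : ∀ x, x ∈ levelHom hst w.1 '' betaSet lam.1
      ↔ (levelHom hst w.1).symm x ∈ betaSet lam.1 := fun x => by
    rw [Equiv.image_eq_preimage_symm, Set.mem_preimage]
  have hsymm : ∀ x, (levelHom hst w.1).symm (-1 - x) = -1 - (levelHom hst w.1).symm x := by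
    intro x
    rw [Equiv.symm_apply_eq, levelHom_symm, Equiv.apply_symm_apply]
  have hper : ∀ x, (levelHom hst w.1).symm (x - s) = (levelHom hst w.1).symm x - s := by
    intro x
    have := levelHom_periodic hst w.1 ((levelHom hst w.1).symm x - s)
    rw [sub_add_cancel, Equiv.apply_symm_apply] at this
    rw [Equiv.symm_apply_eq]
    omega
  obtain ⟨mu, hmu⟩ := exists_betaSet_eq (levelHom hst w.1 '' betaSet lam.1)
    (fun x => by rw [himg, himg, hsymm]; exact lam.mem_symm _)
    (by
      obtain ⟨D, hD⟩ := levelHom_le hs0 hst w.1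
      obtain ⟨B, hB⟩ := betaSet_bddAbove lam.1
      refine ⟨B + D, ?_⟩
      rintro _ ⟨x, hx, rfl⟩
      have := hD x
      have := hB hx
      linarith)
  refine ⟨⟨mu, (isCore_iff hs0 _).2 ?_, (isSelfConjugate_iff _).2 ?_⟩, hmu⟩
  · intro b hb
    rw [hmu, himg] at hb ⊢
    rw [hper]
    exact lam.sub_mem hs0 _ hb
  · intro x
    rw [hmu, himg, himg, hsymm]
    exact lam.mem_symm _

/-- The image of a self-conjugate `s`-core `λ` under `w`: its beta-set is the image of the beta-set
of `λ` under the level `t` action of `w` on `ℤ`. -/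
noncomputable def levelSMul {s t : ℕ} (hs : 2 ≤ s) (hst : s.Coprime t) (w : AffineHyp hs)
    (lam : SelfConjCore s) : SelfConjCore s :=
  (exists_levelAction hs hst w lam).choose

theorem betaSet_levelSMul {s t : ℕ} (hs : 2 ≤ s) (hst : s.Coprime t) (w : AffineHyp hs)
    (lam : SelfConjCore s) :
    betaSet (levelSMul hs hst w lam).1 = levelHom hst w.1 '' betaSet lam.1 :=
  (exists_levelAction hs hst w lam).choose_spec

theorem one_levelSMul {s t : ℕ} (hs : 2 ≤ s) (hst : s.Coprime t) (lam : SelfConjCore s) :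
    levelSMul hs hst 1 lam = lam := by
  apply SelfConjCore.ext
  apply betaSet_injective
  rw [betaSet_levelSMul]
  simp

theorem mul_levelSMul {s t : ℕ} (hs : 2 ≤ s) (hst : s.Coprime t) (v w : AffineHyp hs)
    (lam : SelfConjCore s) :
    levelSMul hs hst (v * w) lam = levelSMul hs hst v (levelSMul hs hst w lam) := by
  apply SelfConjCore.ext
  apply betaSet_injective
  rw [betaSet_levelSMul, betaSet_levelSMul, betaSet_levelSMul, Set.image_image]
  simp

/-- The level `t` action of the affine hyperoctahedral group on the set of self-conjugate
`s`-cores. -/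
@[reducible]
noncomputable def levelAction {s t : ℕ} (hs : 2 ≤ s) (hst : s.Coprime t) :
    MulAction (AffineHyp hs) (SelfConjCore s) where
  smul := levelSMul hs hst
  one_smul := one_levelSMul hs hst
  mul_smul := mul_levelSMul hs hst

theorem sSet_levelSMul {s t : ℕ} (hs : 2 ≤ s) (hst : s.Coprime t) (w : AffineHyp hs)
    (lam : SelfConjCore s) (a : ℤ) :
    levelHom hst w.1 a ∈ sSet s (levelSMul hs hst w lam).1 ↔ a ∈ sSet s lam.1 := by
  have hs0 : 0 < s := by omega
  have e : levelHom hst w.1 a - s = levelHom hst w.1 (a - s) := by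
    have := levelHom_periodic hst w.1 (a - s)
    rw [sub_add_cancel] at this
    omega
  rw [SelfConjCore.mem_sSet_iff _ hs0, SelfConjCore.mem_sSet_iff _ hs0, betaSet_levelSMul, e,
    (levelHom hst w.1).injective.mem_set_image, (levelHom hst w.1).injective.mem_set_image]

theorem coreEquiv_levelSMul {s t : ℕ} (hs : 2 ≤ s) (hst : s.Coprime t) {N : ℕ}
    (w : AffineHyp hs) {lam mu : SelfConjCore s} (h : CoreEquiv s N lam.1 mu.1) :
    CoreEquiv s N (levelSMul hs hst w lam).1 (levelSMul hs hst w mu).1 := by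
  have hs0 : 0 < s := by omega
  rw [SelfConjCore.coreEquiv_iff hs0] at h ⊢
  intro a ha b hb hab
  obtain ⟨a, rfl⟩ := (levelHom hst w.1).surjective a
  obtain ⟨b, rfl⟩ := (levelHom hst w.1).surjective b
  rw [sSet_levelSMul] at ha hb
  refine periodic_modEq (levelHom_periodic hst w.1) (h a ha b hb ?_)
  have hinv := periodic_modEq (periodic_inv (levelHom_periodic hst w.1)) (N := 1)
    (show levelHom hst w.1 a ≡ levelHom hst w.1 b [ZMOD (1 * s)] by rwa [one_mul])
  simpa using hinv

/-- The image of a self-conjugate `s`-core `λ` of spread less than `N s` under `w`: the unique such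
core that is equivalent under `≡_N` to the image of `λ` under the level `t` action of `w` on
self-conjugate `s`-cores. -/
noncomputable def boundedLevelSMul {s t : ℕ} (hs : 2 ≤ s) (hst : s.Coprime t) {N : ℕ}
    (hN : 0 < N) (w : AffineHyp hs) (lam : BoundedSelfConjCore s N) : BoundedSelfConjCore s N :=
  (SelfConjCore.exists_bounded (Nat.zero_lt_of_lt hs) hN (levelSMul hs hst w lam.1)).choose

theorem coreEquiv_boundedLevelSMul {s t : ℕ} (hs : 2 ≤ s) (hst : s.Coprime t) {N : ℕ}
    (hN : 0 < N) (w : AffineHyp hs) (lam : BoundedSelfConjCore s N) :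
    CoreEquiv s N (levelSMul hs hst w lam.1).1 (boundedLevelSMul hs hst hN w lam).1.1 :=
  (SelfConjCore.exists_bounded (Nat.zero_lt_of_lt hs) hN (levelSMul hs hst w lam.1)).choose_spec

theorem eq_boundedLevelSMul {s t : ℕ} (hs : 2 ≤ s) (hst : s.Coprime t) {N : ℕ}
    (hN : 0 < N) (w : AffineHyp hs) (lam mu : BoundedSelfConjCore s N)
    (h : CoreEquiv s N (levelSMul hs hst w lam.1).1 mu.1.1) :
    boundedLevelSMul hs hst hN w lam = mu := by
  have hs0 : 0 < s := by omega
  apply BoundedSelfConjCore.ext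
  refine SelfConjCore.eq_of_coreEquiv hs0 (boundedLevelSMul hs hst hN w lam).2 mu.2 ?_
  exact SelfConjCore.coreEquiv_trans hs0
    (SelfConjCore.coreEquiv_symm hs0 (coreEquiv_boundedLevelSMul hs hst hN w lam)) h

/-- The level `t` action of the affine hyperoctahedral group on the set of self-conjugate
`s`-cores of spread less than `N s`. -/
@[reducible]
noncomputable def boundedLevelAction {s t : ℕ} (hs : 2 ≤ s) (hst : s.Coprime t) {N : ℕ}
    (hN : 0 < N) : MulAction (AffineHyp hs) (BoundedSelfConjCore s N) where
  smul := boundedLevelSMul hs hst hN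
  one_smul lam := by
    refine eq_boundedLevelSMul hs hst hN 1 lam lam ?_
    rw [one_levelSMul]
    exact ⟨Equiv.refl _, fun _ => Int.ModEq.refl _⟩
  mul_smul v w lam := by
    refine eq_boundedLevelSMul hs hst hN (v * w) lam
      (boundedLevelSMul hs hst hN v (boundedLevelSMul hs hst hN w lam)) ?_
    rw [mul_levelSMul]
    exact SelfConjCore.coreEquiv_trans (Nat.zero_lt_of_lt hs)
      (coreEquiv_levelSMul hs hst v (coreEquiv_boundedLevelSMul hs hst hN w lam))
      (coreEquiv_boundedLevelSMul hs hst hN v _)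

theorem mul_pos_of_coprime {s t n : ℕ} (hs : 2 ≤ s) (hst : s.Coprime t) (hn : 1 ≤ n) :
    0 < n * t := by
  refine Nat.mul_pos hn (Nat.pos_of_ne_zero ?_)
  rintro rfl
  rw [Nat.coprime_zero_right] at hst
  omega

/-- The stabiliser of a self-conjugate `s`-core under the level `t` action of the affine
hyperoctahedral group on the set of all self-conjugate `s`-cores. -/
noncomputable def stabSC {s t : ℕ} (hs : 2 ≤ s) (hst : s.Coprime t) (lam : SelfConjCore s) :
    Subgroup (AffineHyp hs) :=
  letI := levelAction hs hst
  MulAction.stabilizer (AffineHyp hs) lam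

/-- The orbit of a core under the level `t` action of the affine hyperoctahedral group on the
finite set of self-conjugate `s`-cores of spread less than `N s`. -/
noncomputable def levelOrbit {s t : ℕ} (hs : 2 ≤ s) (hst : s.Coprime t) {N : ℕ} (hN : 0 < N)
    (lam : BoundedSelfConjCore s N) : Set (BoundedSelfConjCore s N) :=
  letI := boundedLevelAction hs hst hN
  MulAction.orbit (AffineHyp hs) lam

end SCCore

/-!
Let `u = s / 2` and `c = ½ (s - 1) (t - 1)`. The group generated by `m ↦ m + s` and `m ↦ -1 - m` is
infinite dihedral, and its free orbits on `ℤ` are those of `0, …, u - 1`. Hence the maps commuting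
with it are given by the images of these `u` integers, and `H_s` realises all choices of images in
distinct free orbits: a signed permutation together with a translation in `ℤ ^ u`. The subgroup
`Γ_n` of elements congruent to the identity modulo `n s` corresponds to `(n ℤ) ^ u`, so it has index
`(2 n) ^ u u!`.

For a core `λ` let `q_λ i = a - i t`, where `a` is the element of its `s`-set congruent to
`i t - c` modulo `s`. Then `q_{w λ} ∘ w = q_λ` for the level `t` action, and
`q_λ (i + s k) = q_λ i - s k t`. This shows that each element of `Γ_n` maps `λ` to a core equivalent
modulo `n t`, that `Γ_n` acts freely on cores, and that it is transitive on each equivalence class.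
The stabiliser of the class of `λ` is therefore the product of `Γ_n` with the stabiliser of `λ`,
which meets `Γ_n` trivially, and the orbit-stabiliser theorem gives the formula.
-/

namespace SCCore

instance {s : ℕ} {hs : 2 ≤ s} : CoeFun (AffineHyp hs) fun _ => ℤ → ℤ :=
  ⟨fun w => (w.1 : Equiv.Perm ℤ)⟩

/-! ### Maps commuting with `m ↦ m + s` and `m ↦ -1 - m` -/

/-- The maps `ℤ → ℤ` commuting with the translation by `s` and with the reflection `m ↦ -1 - m`.
Every element of the affine hyperoctahedral group is one. -/
structure IsEquivariant (s : ℕ) (v : ℤ → ℤ) : Prop where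
  add_period : ∀ m, v (m + s) = v m + s
  reflect : ∀ m, v (-1 - m) = -1 - v m

theorem AffineHyp.isEquivariant {s : ℕ} {hs : 2 ≤ s} (w : AffineHyp hs) : IsEquivariant s w :=
  ⟨AffineSymm.periodic w.1, AffineHyp.symm w⟩

theorem isEquivariant_id {s : ℕ} : IsEquivariant s id := ⟨fun _ => rfl, fun _ => rfl⟩

/-- The action of a sign on `ℤ`, with `-1` (encoded as `true`) acting by the reflection
`r ↦ -1 - r`. -/
def signed (ε : Bool) (r : ℤ) : ℤ := if ε then -1 - r else r

theorem signed_signed (ε δ : Bool) (r : ℤ) : signed ε (signed δ r) = signed (ε ^^ δ) r := by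
  cases ε <;> cases δ <;> simp [signed]

theorem signed_modEq_signed {M r r' : ℤ} (ε : Bool) (h : r ≡ r' [ZMOD M]) :
    signed ε r ≡ signed ε r' [ZMOD M] := by
  cases ε
  · exact h
  · exact h.sub_left (-1)

theorem exists_modEq_signed {s : ℕ} (hs : 0 < s) {m : ℤ} (hm : ¬ m ≡ -1 - m [ZMOD s]) :
    ∃ (r : Fin (s / 2)) (ε : Bool), m ≡ signed ε (r : ℕ) [ZMOD s] := by
  have h_nonneg := Int.emod_nonneg m (show (s : ℤ) ≠ 0 by lia)
  have h_lt := Int.emod_lt_of_pos m (show (0 : ℤ) < s by lia)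
  have h_mod : m % s ≡ m [ZMOD s] := Int.mod_modEq m s
  generalize m % s = r at *
  by_cases h_low : r < s / 2
  · lift r to ℕ using h_nonneg
    exact ⟨⟨r, by lia⟩, false, h_mod.symm⟩
  by_cases h_high : s - 1 - r < s / 2
  · refine ⟨⟨(s - 1 - r).toNat, by lia⟩, true, h_mod.symm.trans ?_⟩
    rw [Int.modEq_iff_dvd]
    exact ⟨-1, by simp only [signed, if_true]; lia⟩
  · refine absurd (h_mod.symm.trans (Int.ModEq.trans ?_ (h_mod.sub_left (-1)))) hm
    rw [Int.modEq_iff_dvd]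
    exact ⟨-1, by lia⟩

namespace IsEquivariant

variable {s : ℕ} {v w : ℤ → ℤ}

theorem map_signed (hv : IsEquivariant s v) (ε : Bool) (m : ℤ) :
    v (signed ε m) = signed ε (v m) := by
  cases ε
  · rfl
  · exact hv.reflect m

theorem apply_eq_of_modEq_reflect (hv : IsEquivariant s v) {m : ℤ} (hm : m ≡ -1 - m [ZMOD s]) :
    v m = m := by
  obtain ⟨k, hk⟩ := hm.dvd
  have h := periodic_add_mul hv.add_period m k
  rw [← hk, show m + (-1 - m - m) = -1 - m by ring, hv.reflect] at h
  lia

theorem modEq_of_modEq_on_half (hs : 0 < s) (hv : IsEquivariant s v) (hw : IsEquivariant s w)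
    {M : ℤ} (h : ∀ i : Fin (s / 2), v (i : ℕ) ≡ w (i : ℕ) [ZMOD M]) (m : ℤ) :
    v m ≡ w m [ZMOD M] := by
  by_cases hm : m ≡ -1 - m [ZMOD s]
  · rw [hv.apply_eq_of_modEq_reflect hm, hw.apply_eq_of_modEq_reflect hm]
  · obtain ⟨r, ε, hr⟩ := exists_modEq_signed hs hm
    obtain ⟨k, hk⟩ := hr.symm.dvd
    rw [sub_eq_iff_eq_add'] at hk
    rw [hk, periodic_add_mul hv.add_period, periodic_add_mul hw.add_period, hv.map_signed,
      hw.map_signed]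
    exact (signed_modEq_signed ε (h r)).add_right _

theorem eq_of_eq_on_half (hs : 0 < s) (hv : IsEquivariant s v) (hw : IsEquivariant s w)
    (h : ∀ i : Fin (s / 2), v (i : ℕ) = w (i : ℕ)) : v = w :=
  funext fun m => by
    simpa using hv.modEq_of_modEq_on_half hs hw (M := 0) (fun i => by simp [h]) m

end IsEquivariant

theorem AffineHyp.ext_half {s : ℕ} {hs : 2 ≤ s} {v w : AffineHyp hs}
    (h : ∀ i : Fin (s / 2), v (i : ℕ) = w (i : ℕ)) : v = w :=
  Subtype.ext <| Subtype.ext <| DFunLike.coe_injective <|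
    (isEquivariant v).eq_of_eq_on_half (by lia) (isEquivariant w) h

theorem AffineHyp.apply_modEq_apply_iff {s : ℕ} {hs : 2 ≤ s} (w : AffineHyp hs) {N m m' : ℤ} :
    w m ≡ w m' [ZMOD (N * s)] ↔ m ≡ m' [ZMOD (N * s)] := by
  refine ⟨fun h => ?_, periodic_modEq (AffineSymm.periodic w.1)⟩
  simpa using periodic_modEq (periodic_inv (AffineSymm.periodic w.1)) h

/-! ### Windows -/

/-- The integers `f i` lie in pairwise distinct orbits of the group generated by `m ↦ m + s` and
`m ↦ -1 - m`, and these orbits are free. The values on `0, …, s / 2 - 1` of an element of the affine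
hyperoctahedral group form such a family. -/
def IsWindow (s : ℕ) {ι : Type*} (f : ι → ℤ) : Prop :=
  ∀ ⦃i j : ι⦄ ⦃ε δ : Bool⦄, signed ε (f i) ≡ signed δ (f j) [ZMOD s] → i = j ∧ ε = δ

theorem isWindow_val (s : ℕ) : IsWindow s fun i : Fin (s / 2) => ((i : ℕ) : ℤ) := by
  rintro ⟨i, hi⟩ ⟨j, hj⟩ ε δ h
  obtain ⟨k, hk⟩ := h.dvd
  have hk_lt : k < 1 := by
    by_contra!
    have : (s : ℤ) ≤ s * k := by nlinarith
    cases ε <;> cases δ <;> simp only [signed] at hk <;> lia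
  have hk_gt : -1 < k := by
    by_contra!
    have : s * k ≤ -(s : ℤ) := by nlinarith
    cases ε <;> cases δ <;> simp only [signed] at hk <;> lia
  obtain rfl : k = 0 := by lia
  cases ε <;> cases δ <;> grind [signed]

namespace IsWindow

variable {s : ℕ} {ι κ : Type*} {f g : ι → ℤ}

theorem comp_injective (hf : IsWindow s f) {σ : κ → ι} (hσ : Function.Injective σ) :
    IsWindow s (f ∘ σ) := fun _ _ _ _ h =>
  (hf h).imp_left fun hij => hσ hij

theorem of_modEq_signed (hf : IsWindow s f) {ε : ι → Bool}
    (h : ∀ i, g i ≡ signed (ε i) (f i) [ZMOD s]) : IsWindow s g := fun i j δ δ' hij => by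
  have key : signed (δ ^^ ε i) (f i) ≡ signed (δ' ^^ ε j) (f j) [ZMOD s] := by
    rw [← signed_signed, ← signed_signed]
    exact (signed_modEq_signed δ (h i)).symm.trans (hij.trans (signed_modEq_signed δ' (h j)))
  obtain ⟨rfl, hδ⟩ := hf key
  exact ⟨rfl, by simpa using hδ⟩

theorem injective (hf : IsWindow s f) : Function.Injective f := fun i j hij =>
  (hf (ε := false) (δ := false) (by rw [hij])).1

theorem not_modEq_reflect (hf : IsWindow s f) (i : ι) : ¬ f i ≡ -1 - f i [ZMOD s] := fun h =>
  Bool.false_ne_true (hf (i := i) (j := i) (ε := false) (δ := true) h).2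

theorem update [DecidableEq ι] (hf : IsWindow s f) {a : ι} {x : ℤ} (hx : x ≡ -1 - f a [ZMOD s]) :
    IsWindow s (Function.update f a x) := by
  refine hf.of_modEq_signed (ε := fun i => decide (i = a)) fun i => ?_
  by_cases hi : i = a
  · subst hi
    simpa [signed] using hx
  · simp [hi, signed]

end IsWindow

theorem AffineHyp.isWindow {s : ℕ} {hs : 2 ≤ s} (w : AffineHyp hs) {ι : Type*} {f : ι → ℤ}
    (hf : IsWindow s f) : IsWindow s fun i => w (f i) := fun i j ε δ h => by
  rw [← (isEquivariant w).map_signed, ← (isEquivariant w).map_signed, ← one_mul (s : ℤ),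
    apply_modEq_apply_iff, one_mul] at h
  exact hf h

/-! ### Every window is realised -/

theorem natCast_ne_zero_of_lt {s i : ℕ} (hi : 1 ≤ i) (his : i < s) : (i : ZMod s) ≠ 0 := by
  rw [Ne, ZMod.natCast_eq_zero_iff]
  exact Nat.not_dvd_of_pos_of_lt hi his

theorem neg_natCast_eq_natCast_sub {s i : ℕ} (his : i ≤ s) :
    -(i : ZMod s) = ((s - i : ℕ) : ZMod s) := by
  simp [Nat.cast_sub his]

theorem genWFun_natCast {s i m : ℕ} (hi : 1 ≤ i) (his : i < s) (hm : m < s) :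
    genWFun (i : ZMod s) m = (Equiv.swap (i - 1) i m : ℕ) := by
  have cast_eq_iff {j : ℕ} (hj : j < s) : (m : ZMod s) = j ↔ m = j :=
    (CharP.natCast_injOn_Iio (ZMod s) s).eq_iff hm hj
  have h_pred := cast_eq_iff (j := i - 1) (by lia)
  rw [Nat.cast_pred hi] at h_pred
  simp only [genWFun, Int.cast_natCast, cast_eq_iff his, h_pred, Equiv.swap_apply_def]
  split_ifs <;> lia

theorem genWFun_zero_natCast {s m : ℕ} (hm : m + 1 < s) :
    genWFun (0 : ZMod s) m = if m = 0 then -1 else (m : ℤ) := by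
  have h_zero : (m : ZMod s) = 0 ↔ m = 0 := by
    simpa using (CharP.natCast_injOn_Iio (ZMod s) s).eq_iff (x := m) (y := 0)
      (Set.mem_Iio.2 (by lia)) (Set.mem_Iio.2 (by lia))
  have h_neg_one : (m : ZMod s) ≠ 0 - 1 := by
    rw [zero_sub, Ne, eq_neg_iff_add_eq_zero, ← Nat.cast_add_one]
    exact natCast_ne_zero_of_lt m.succ_pos hm
  simp only [genWFun, Int.cast_natCast, h_neg_one, h_zero, if_false]
  split_ifs with h <;> simp [h]

theorem swap_lt {a b m n : ℕ} (ha : a < n) (hb : b < n) (hm : m < n) : Equiv.swap a b m < n := by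
  rw [Equiv.swap_apply_def]
  split_ifs <;> assumption

section Generators

variable {s : ℕ} (hs : 2 ≤ s)

theorem genV_zero_apply {j : ℕ} (hj : j < s / 2) :
    (genV hs 0 : Equiv.Perm ℤ) j = if j = 0 then -1 else (j : ℤ) := by
  rw [← genWFun_zero_natCast (s := s) (by lia), genV, if_pos rfl]
  rfl

theorem genV_apply_of_lt {i j : ℕ} (hi : 1 ≤ i) (his : i < s / 2) (hj : j < s / 2) :
    (genV hs (i : ZMod s) : Equiv.Perm ℤ) j = (Equiv.swap (i - 1) i j : ℕ) := by
  have cast_ne {k : ℕ} (hk : k < s) (hik : i ≠ k) : (i : ZMod s) ≠ k :=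
    ((CharP.natCast_injOn_Iio (ZMod s) s).ne_iff (Set.mem_Iio.2 (by lia)) hk).2 hik
  have h_half : ¬((i : ZMod s) = (s / 2 : ℕ) ∨ (i : ZMod s) = -(s / 2 : ℕ)) := by
    rw [neg_natCast_eq_natCast_sub (by lia)]
    exact not_or.2 ⟨cast_ne (by lia) (by lia), cast_ne (by lia) (by lia)⟩
  rw [genV, if_neg (natCast_ne_zero_of_lt hi (by lia)), if_neg h_half]
  change genWFun (i : ZMod s) (genWFun (-(i : ZMod s)) j) = _
  rw [neg_natCast_eq_natCast_sub (by lia), genWFun_natCast (by lia) (by lia) (by lia),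
    Equiv.swap_apply_of_ne_of_ne (by lia) (by lia), genWFun_natCast hi (by lia) (by lia)]

theorem genV_half_apply {j : ℕ} (hj : j < s / 2) :
    (genV hs ((s / 2 : ℕ) : ZMod s) : Equiv.Perm ℤ) j
      = if j = s / 2 - 1 then (s : ℤ) - 1 - j else j := by
  rw [genV, if_neg (natCast_ne_zero_of_lt (by lia) (by lia)), if_pos (Or.inl rfl)]
  change genWFun ((s / 2 : ℕ) : ZMod s) (genWFun (-((s / 2 : ℕ) : ZMod s))
    (genWFun ((s / 2 : ℕ) : ZMod s) j)) = _
  rw [neg_natCast_eq_natCast_sub (by lia), genWFun_natCast (by lia) (by lia) (by lia),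
    genWFun_natCast (by lia) (by lia) (swap_lt (by lia) (by lia) (by lia)),
    genWFun_natCast (by lia) (by lia)
      (swap_lt (by lia) (by lia) (swap_lt (by lia) (by lia) (by lia)))]
  simp only [Equiv.swap_apply_def]
  split_ifs <;> lia

/-- The family `f` consists of the values on `0, …, s / 2 - 1` of an element of the affine
hyperoctahedral group. -/
def IsRealizable (f : Fin (s / 2) → ℤ) : Prop :=
  ∃ w : AffineHyp hs, ∀ i : Fin (s / 2), w (i : ℕ) = f i

variable {hs}

theorem IsRealizable.of_genV {f : Fin (s / 2) → ℤ} (i : ZMod s) {g : Fin (s / 2) → ℤ}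
    (hg : IsRealizable hs g)
    (hfg : ∀ w : AffineHyp hs, (∀ j : Fin (s / 2), w (j : ℕ) = g j) →
      ∀ j : Fin (s / 2), w ((genV hs i : Equiv.Perm ℤ) (j : ℕ)) = f j) :
    IsRealizable hs f := by
  obtain ⟨w, hw⟩ := hg
  let v : AffineHyp hs := ⟨genV hs i, Subgroup.subset_closure ⟨i, rfl⟩⟩
  exact ⟨w * v, hfg w hw⟩

theorem IsRealizable.of_update_first {f : Fin (s / 2) → ℤ} {a : Fin (s / 2)} (ha : (a : ℕ) = 0)
    (h : IsRealizable hs (Function.update f a (-1 - f a))) : IsRealizable hs f := by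
  refine h.of_genV 0 fun w hw j => ?_
  have hwj := hw j
  rw [genV_zero_apply hs j.2]
  split_ifs with hj
  · obtain rfl : j = a := Fin.ext (hj.trans ha.symm)
    have h_reflect := (AffineHyp.isEquivariant w).reflect 0
    rw [Function.update_self, ha, Nat.cast_zero] at hwj
    rw [hwj] at h_reflect
    simpa using h_reflect
  · rwa [Function.update_of_ne (by rintro rfl; exact hj ha)] at hwj

theorem IsRealizable.of_update_last {f : Fin (s / 2) → ℤ} {a : Fin (s / 2)}
    (ha : (a : ℕ) = s / 2 - 1) (h : IsRealizable hs (Function.update f a (s - 1 - f a))) :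
    IsRealizable hs f := by
  refine h.of_genV ((s / 2 : ℕ) : ZMod s) fun w hw j => ?_
  have hwj := hw j
  rw [genV_half_apply hs j.2]
  split_ifs with hj
  · obtain rfl : j = a := Fin.ext (hj.trans ha.symm)
    rw [Function.update_self] at hwj
    rw [show (s : ℤ) - 1 - (j : ℕ) = -1 - (j : ℕ) + s by ring,
      (AffineHyp.isEquivariant w).add_period, (AffineHyp.isEquivariant w).reflect, hwj]
    ring
  · rwa [Function.update_of_ne (by rintro rfl; exact hj ha)] at hwj

theorem IsRealizable.of_comp_swap {f : Fin (s / 2) → ℤ} {a b : Fin (s / 2)} (hab : a ⋖ b)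
    (h : IsRealizable hs (f ∘ Equiv.swap a b)) : IsRealizable hs f := by
  rw [Fin.covBy_iff, Nat.covBy_iff_add_one_eq] at hab
  refine h.of_genV ((b : ℕ) : ZMod s) fun w hw j => ?_
  have h_swap : Equiv.swap ((b : ℕ) - 1) b (j : ℕ) = (Equiv.swap a b j : Fin (s / 2)) := by
    simp only [Equiv.swap_apply_def, apply_ite Fin.val, Fin.ext_iff]
    split_ifs <;> lia
  rw [genV_apply_of_lt hs (by lia) b.2 j.2, h_swap, hw, Function.comp_apply, Equiv.swap_apply_self]

end Generators

theorem sum_sq_update_lt {ι : Type*} [Fintype ι] [DecidableEq ι] (f c : ι → ℤ) {a : ι} {x : ℤ}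
    (hx : (x - c a) ^ 2 < (f a - c a) ^ 2) :
    ∑ i, (Function.update f a x i - c i) ^ 2 < ∑ i, (f i - c i) ^ 2 := by
  refine Finset.sum_lt_sum (fun i _ => ?_) ⟨a, Finset.mem_univ a, by simpa using hx⟩
  rcases eq_or_ne i a with rfl | h
  · simpa using hx.le
  · rw [Function.update_of_ne h]

theorem sum_sq_swap_lt {ι : Type*} [Fintype ι] [DecidableEq ι] (f c : ι → ℤ) {a b : ι}
    (hc : c a < c b) (hf : f b < f a) :
    ∑ i, ((f ∘ Equiv.swap a b) i - c i) ^ 2 < ∑ i, (f i - c i) ^ 2 := by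
  have hab : a ≠ b := by rintro rfl; exact hc.false
  rw [← sub_neg, ← Finset.sum_sub_distrib,
    Fintype.sum_eq_add a b hab fun i hi => by
      rw [Function.comp_apply, Equiv.swap_apply_of_ne_of_ne hi.1 hi.2, sub_self],
    Function.comp_apply, Function.comp_apply, Equiv.swap_apply_left, Equiv.swap_apply_right]
  nlinarith [mul_pos (sub_pos.2 hc) (sub_pos.2 hf)]

theorem eq_val_of_strictMono {u : ℕ} {f : Fin u → ℤ} (hf : StrictMono f)
    (h_nonneg : ∀ i, 0 ≤ f i) (h_lt : ∀ i, f i < u) (i : Fin u) : f i = (i : ℕ) := by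
  have h_toNat_lt (i : Fin u) : (f i).toNat < u := by
    have := h_nonneg i
    have := h_lt i
    lia
  have h_mono : StrictMono fun i => (⟨(f i).toNat, h_toNat_lt i⟩ : Fin u) := fun i j hij => by
    have := h_nonneg i
    have := hf hij
    exact Fin.mk_lt_mk.2 (by lia)
  have h_id : (f i).toNat = i := Fin.ext_iff.1 (le_antisymm h_mono.apply_le h_mono.le_apply)
  rw [← h_id, Int.toNat_of_nonneg (h_nonneg i)]

/-- As long as `f` is not the identity, one of the generators moves its values closer to those of
the identity. -/
theorem IsWindow.isRealizable {s : ℕ} (hs : 2 ≤ s) {f : Fin (s / 2) → ℤ} (hf : IsWindow s f) :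
    IsRealizable hs f := by
  obtain ⟨d, hd⟩ : ∃ d : ℕ, (∑ i, (f i - (i : ℕ)) ^ 2).toNat = d := ⟨_, rfl⟩
  induction d using Nat.strong_induction_on generalizing f with
  | _ d ih =>
    have closer {g : Fin (s / 2) → ℤ} (hg : IsWindow s g)
        (hlt : ∑ i, (g i - (i : ℕ)) ^ 2 < ∑ i, (f i - (i : ℕ)) ^ 2) : IsRealizable hs g := by
      refine ih _ ?_ hg rfl
      have : 0 ≤ ∑ i, (g i - (i : ℕ)) ^ 2 := Finset.sum_nonneg fun i _ => sq_nonneg _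
      lia
    let first : Fin (s / 2) := ⟨0, by lia⟩
    let last : Fin (s / 2) := ⟨s / 2 - 1, by lia⟩
    by_cases h_first : f first < 0
    · exact .of_update_first (a := first) rfl <| closer (hf.update (Int.ModEq.refl _)) <|
        sum_sq_update_lt f (fun i => ((i : ℕ) : ℤ)) <| by push_cast [first]; nlinarith
    by_cases h_last : ((s / 2 - 1 : ℕ) : ℤ) < f last
    · have h_reflect : (s : ℤ) - 1 - f last ≡ -1 - f last [ZMOD s] := by
        rw [Int.modEq_iff_dvd]
        exact ⟨-1, by ring⟩
      have h_ne : f last ≠ s - 1 - f last := fun h =>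
        hf.not_modEq_reflect last (by rwa [← h] at h_reflect)
      refine .of_update_last (a := last) rfl <| closer (hf.update h_reflect) <|
        sum_sq_update_lt f _ ?_
      rw [sq_lt_sq, abs_of_pos (sub_pos.2 h_last), abs_lt]
      constructor <;> lia
    by_cases h_mono : ∃ a b : Fin (s / 2), a ⋖ b ∧ f b < f a
    · obtain ⟨a, b, hab, h_lt⟩ := h_mono
      exact .of_comp_swap hab <| closer (hf.comp_injective (Equiv.injective _)) <|
        sum_sq_swap_lt f _ (by exact_mod_cast hab.lt) h_lt
    · push Not at h_mono
      have hf_mono : StrictMono f := (strictMono_iff_forall_covBy f).2 fun a b hab =>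
        (h_mono a b hab).lt_of_ne (hf.injective.ne hab.ne)
      have h_id := eq_val_of_strictMono hf_mono
        (fun i => (not_lt.1 h_first).trans (hf_mono.monotone (Fin.mk_le_of_le_val (by simp))))
        fun i => (hf_mono.monotone (Fin.mk_le_mk.2 (by lia) : i ≤ last)).trans_lt (by lia)
      exact ⟨1, fun i => (h_id i).symm⟩

/-! ### Congruence subgroups -/

section CongruenceSubgroup

variable {s : ℕ} {hs : 2 ≤ s} {n : ℕ}

/-- The elements of the affine hyperoctahedral group that fix every integer modulo `n s`. For
`n = 1` this is the translation lattice, and in general it is `n` times that lattice. -/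
def congruenceSubgroup (hs : 2 ≤ s) (n : ℕ) : Subgroup (AffineHyp hs) where
  carrier := {w | ∀ m : ℤ, w m ≡ m [ZMOD (n * s)]}
  one_mem' := fun m => Int.ModEq.refl _
  mul_mem' := fun {v w} hv hw m => (hv (w m)).trans (hw m)
  inv_mem' := fun {w} hw m => by simpa using (hw ((w⁻¹ : AffineHyp hs) m)).symm

instance congruenceSubgroup_normal : (congruenceSubgroup hs n).Normal where
  conj_mem w hw g m := by
    simpa using (AffineHyp.apply_modEq_apply_iff g).2 (hw ((g⁻¹ : AffineHyp hs) m))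

theorem inv_mul_mem_congruenceSubgroup {v w : AffineHyp hs} :
    v⁻¹ * w ∈ congruenceSubgroup hs n ↔
      ∀ i : Fin (s / 2), v (i : ℕ) ≡ w (i : ℕ) [ZMOD (n * s)] := by
  have apply_iff (m : ℤ) :
      (v⁻¹ * w : AffineHyp hs) m ≡ m [ZMOD (n * s)] ↔ v m ≡ w m [ZMOD (n * s)] := by
    rw [← AffineHyp.apply_modEq_apply_iff v, Int.modEq_comm]
    simp
  refine ⟨fun h i => (apply_iff _).1 (h _), fun h m => ?_⟩
  exact (AffineHyp.isEquivariant _).modEq_of_modEq_on_half (by lia) isEquivariant_id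
    (fun i => (apply_iff _).2 (h i)) m

theorem exists_affineHyp_apply_eq_signed (hs : 2 ≤ s) (σ : Equiv.Perm (Fin (s / 2)))
    (ε : Fin (s / 2) → Bool) (k : Fin (s / 2) → ℤ) :
    ∃ w : AffineHyp hs, ∀ i : Fin (s / 2), w (i : ℕ) = signed (ε i) (σ i : ℕ) + s * k i :=
  (((isWindow_val s).comp_injective σ.injective).of_modEq_signed (ε := ε) fun i => by
    simp [Int.ModEq]).isRealizable hs

theorem AffineHyp.exists_apply_eq_signed (w : AffineHyp hs) :
    ∃ (σ : Equiv.Perm (Fin (s / 2))) (ε : Fin (s / 2) → Bool) (k : Fin (s / 2) → ℤ),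
      ∀ i : Fin (s / 2), w (i : ℕ) = signed (ε i) (σ i : ℕ) + s * k i := by
  have hw := isWindow w (isWindow_val s)
  choose σ ε hσ using fun i => exists_modEq_signed (by lia) (hw.not_modEq_reflect i)
  have hσ_inj : Function.Injective σ := fun i j hij => by
    have h_signed (i : Fin (s / 2)) : signed (ε i) (w (i : ℕ)) ≡ (σ i : ℕ) [ZMOD s] := by
      have h := signed_modEq_signed (ε i) (hσ i)
      rw [signed_signed, Bool.xor_self] at h
      exact h
    exact (hw ((h_signed i).trans (hij ▸ (h_signed j).symm))).1
  choose k hk using fun i => (hσ i).symm.dvd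
  exact ⟨Equiv.ofBijective σ (Finite.injective_iff_bijective.1 hσ_inj), ε, k,
    fun i => sub_eq_iff_eq_add'.1 (hk i)⟩

theorem signed_add_mul_modEq_iff (hs : 0 < s) {r r' : Fin (s / 2)} {ε δ : Bool} {k l : ℤ} :
    signed ε (r : ℕ) + s * k ≡ signed δ (r' : ℕ) + s * l [ZMOD (n * s)] ↔
      r = r' ∧ ε = δ ∧ k ≡ l [ZMOD n] := by
  refine ⟨fun h => ?_, ?_⟩
  · obtain ⟨rfl, rfl⟩ : r = r' ∧ ε = δ :=
      isWindow_val s (by simpa [Int.ModEq] using h.of_dvd (Dvd.intro_left _ rfl))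
    rw [mul_comm (n : ℤ)] at h
    exact ⟨rfl, rfl, (Int.ModEq.add_left_cancel' _ h).mul_left_cancel' (by lia)⟩
  · rintro ⟨rfl, rfl, h⟩
    rw [mul_comm (n : ℤ)]
    exact h.mul_left'.add_left _

theorem index_congruenceSubgroup (hs : 2 ≤ s) (n : ℕ) :
    (congruenceSubgroup hs n).index = (2 * n) ^ (s / 2) * (s / 2).factorial := by
  choose toHyp h_toHyp using
    fun d : Equiv.Perm (Fin (s / 2)) × (Fin (s / 2) → Bool × ZMod n) =>
      exists_affineHyp_apply_eq_signed hs d.1 (fun i => (d.2 i).1) fun i => ((d.2 i).2.cast : ℤ)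
  have h_bij : Function.Bijective
      fun d => (toHyp d : AffineHyp hs ⧸ congruenceSubgroup hs n) := by
    constructor
    · intro d e hde
      simp only [QuotientGroup.eq, inv_mul_mem_congruenceSubgroup, h_toHyp,
        signed_add_mul_modEq_iff (show 0 < s by lia), ← ZMod.intCast_eq_intCast_iff,
        ZMod.intCast_zmod_cast] at hde
      exact Prod.ext (Equiv.ext fun i => (hde i).1)
        (funext fun i => Prod.ext (hde i).2.1 (hde i).2.2)
    · intro q
      obtain ⟨w, rfl⟩ := QuotientGroup.mk_surjective q
      obtain ⟨σ, ε, k, hw⟩ := AffineHyp.exists_apply_eq_signed w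
      refine ⟨(σ, fun i => (ε i, k i)), ?_⟩
      simp [QuotientGroup.eq, inv_mul_mem_congruenceSubgroup, h_toHyp, hw,
        signed_add_mul_modEq_iff (show 0 < s by lia), ← ZMod.intCast_eq_intCast_iff]
  rw [Subgroup.index, ← Nat.card_eq_of_bijective _ h_bij, Nat.card_prod, Nat.card_fun,
    Nat.card_prod, Nat.card_perm, Nat.card_zmod, Nat.card_fin, Nat.card_eq_fintype_card,
    Fintype.card_bool, mul_comm]

end CongruenceSubgroup

/-! ### Level coordinates of a core -/

namespace SelfConjCore

variable {s : ℕ} (hs : 0 < s) (lam mu : SelfConjCore s)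

/-- The element of the `s`-set of `lam` congruent to `m` modulo `s`. -/
noncomputable def sSetElt (m : ℤ) : ℤ := (lam.exists_sSet hs m).choose

theorem sSetElt_mem (m : ℤ) : lam.sSetElt hs m ∈ sSet s lam.1 :=
  (lam.exists_sSet hs m).choose_spec.1

theorem modEq_sSetElt (m : ℤ) : m ≡ lam.sSetElt hs m [ZMOD s] :=
  (lam.exists_sSet hs m).choose_spec.2

variable {lam} in
theorem eq_sSetElt {a m : ℤ} (ha : a ∈ sSet s lam.1) (h : m ≡ a [ZMOD s]) :
    a = lam.sSetElt hs m :=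
  lam.sSet_unique hs ha (lam.sSetElt_mem hs m) (h.symm.trans (lam.modEq_sSetElt hs m))

/-- With `c = ½ (s - 1) (t - 1)`, the number `a - i t`, where `a` is the element of the `s`-set of
`lam` congruent to `i t - c`. Subtracting `i t` turns the level `t` action on cores into
precomposition with the natural action on `ℤ`: see `levelCoord_levelSMul`. -/
noncomputable def levelCoord (t : ℕ) (i : ℤ) : ℤ := lam.sSetElt hs (i * t - levelShift s t) - i * t

variable (t : ℕ)

theorem levelCoord_add_mem (i : ℤ) : lam.levelCoord hs t i + i * t ∈ sSet s lam.1 := by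
  rw [levelCoord, sub_add_cancel]
  exact lam.sSetElt_mem hs _

theorem modEq_levelCoord_add (i : ℤ) :
    i * t ≡ lam.levelCoord hs t i + i * t + levelShift s t [ZMOD s] := by
  rw [levelCoord, sub_add_cancel]
  simpa using (lam.modEq_sSetElt hs (i * t - levelShift s t)).add_right (levelShift s t)

variable {lam t} in
theorem eq_levelCoord_add {a i : ℤ} (ha : a ∈ sSet s lam.1)
    (hi : i * t ≡ a + levelShift s t [ZMOD s]) : a = lam.levelCoord hs t i + i * t := by
  rw [levelCoord, sub_add_cancel]
  exact eq_sSetElt hs ha (by simpa using hi.sub_right (levelShift s t))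

theorem levelCoord_add_mul (i k : ℤ) :
    lam.levelCoord hs t (i + s * k) = lam.levelCoord hs t i - s * k * t := by
  have h := eq_levelCoord_add hs (i := i + s * k) (lam.levelCoord_add_mem hs t i)
    (by simpa [add_mul, mul_assoc, Int.ModEq] using lam.modEq_levelCoord_add hs t i)
  linear_combination -h

variable {t}

theorem levelCoord_reflect (hst : s.Coprime t) (i : ℤ) :
    lam.levelCoord hs t (-1 - i) = s - 1 + t - lam.levelCoord hs t i := by
  have h := eq_levelCoord_add hs (t := t) (i := -1 - i)
    (lam.sSet_symm hs (lam.levelCoord_add_mem hs t i)) <| by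
      obtain ⟨k, hk⟩ := (lam.modEq_levelCoord_add hs t i).dvd
      rw [Int.modEq_iff_dvd]
      exact ⟨t - k, by linear_combination two_mul_levelShift hst - hk⟩
  linear_combination -h

variable {lam mu}

theorem coreEquiv_iff_levelCoord_modEq (hst : s.Coprime t) {N : ℕ} :
    CoreEquiv s N lam.1 mu.1 ↔
      ∀ i, lam.levelCoord hs t i ≡ mu.levelCoord hs t i [ZMOD (N * s)] := by
  rw [coreEquiv_iff hs]
  constructor
  · intro h i
    have h_class := (lam.modEq_levelCoord_add hs t i).symm.trans (mu.modEq_levelCoord_add hs t i)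
    exact Int.ModEq.add_right_cancel' _ <|
      h _ (lam.levelCoord_add_mem hs t i) _ (mu.levelCoord_add_mem hs t i)
        (Int.ModEq.add_right_cancel' _ h_class)
  · intro h a ha b hb hab
    have hi := levelIdx_spec hst a
    rw [eq_levelCoord_add hs ha hi, eq_levelCoord_add hs hb (hi.trans (hab.add_right _))]
    exact (h _).add_right _

theorem eq_of_levelCoord_eq (hst : s.Coprime t)
    (h : ∀ i, lam.levelCoord hs t i = mu.levelCoord hs t i) : lam = mu :=
  eq_of_sSet_subset hs fun a ha => by
    rw [eq_levelCoord_add hs ha (levelIdx_spec hst a), h]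
    exact mu.levelCoord_add_mem hs t _

theorem levelCoord_levelSMul (hs : 2 ≤ s) (hst : s.Coprime t) (w : AffineHyp hs)
    (lam : SelfConjCore s) (i : ℤ) :
    (levelSMul hs hst w lam).levelCoord (Nat.zero_lt_of_lt hs) t (w i) =
      lam.levelCoord (Nat.zero_lt_of_lt hs) t i := by
  have hs0 := Nat.zero_lt_of_lt hs
  have h_class := lam.modEq_levelCoord_add hs0 t i
  have h_apply := levelHom_apply hst w.1 h_class
  have h_mem := (sSet_levelSMul hs hst w lam _).2 (lam.levelCoord_add_mem hs0 t i)
  have h := eq_levelCoord_add hs0 (i := w i) h_mem <| by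
    rw [h_apply]
    simpa [mul_sub, mul_comm, add_assoc, add_comm, add_left_comm] using
      h_class.add_right (t * (w i - i))
  linear_combination h_apply - h

end SelfConjCore

/-! ### Stabilisers -/

section Stabilisers

variable {s t n : ℕ} {hs : 2 ≤ s}

theorem exists_mem_congruenceSubgroup_apply_eq {k : ℤ → ℤ} (hk_period : ∀ i, k (i + s) = k i)
    (hk_reflect : ∀ i, k (-1 - i) = -k i) :
    ∃ w ∈ congruenceSubgroup hs n, ∀ i, w i = i + s * (n * k i) := by
  obtain ⟨w, hw⟩ := exists_affineHyp_apply_eq_signed hs 1 (fun _ => false) fun i => n * k (i : ℕ)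
  have h_apply := congrFun <| (AffineHyp.isEquivariant w).eq_of_eq_on_half
    (w := fun i => i + s * (n * k i)) (by lia)
    ⟨fun m => by rw [hk_period]; ring, fun m => by rw [hk_reflect]; ring⟩ hw
  refine ⟨w, fun m => ?_, h_apply⟩
  rw [h_apply, Int.modEq_iff_dvd]
  exact ⟨-k m, by ring⟩

theorem exists_apply_eq_of_mem_congruenceSubgroup {w : AffineHyp hs}
    (hw : w ∈ congruenceSubgroup hs n) (i : ℤ) : ∃ k : ℤ, w i = i + s * (n * k) := by
  obtain ⟨k, hk⟩ := (hw i).symm.dvd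
  exact ⟨k, by linear_combination hk⟩

theorem coreEquiv_levelSMul_of_mem_congruenceSubgroup (hst : s.Coprime t) {w : AffineHyp hs}
    (hw : w ∈ congruenceSubgroup hs n) (lam : SelfConjCore s) :
    CoreEquiv s (n * t) (levelSMul hs hst w lam).1 lam.1 := by
  rw [SelfConjCore.coreEquiv_iff_levelCoord_modEq (Nat.zero_lt_of_lt hs) hst]
  intro j
  obtain ⟨i, rfl⟩ := (w : Equiv.Perm ℤ).surjective j
  obtain ⟨k, hk⟩ := exists_apply_eq_of_mem_congruenceSubgroup hw i
  rw [SelfConjCore.levelCoord_levelSMul, hk, SelfConjCore.levelCoord_add_mul, Int.modEq_iff_dvd]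
  exact ⟨-k, by push_cast; ring⟩

theorem disjoint_stabSC_congruenceSubgroup (hst : s.Coprime t) (n : ℕ) (lam : SelfConjCore s) :
    Disjoint (stabSC hs hst lam) (congruenceSubgroup hs n) := by
  rw [Subgroup.disjoint_def]
  intro w h_stab hw
  refine AffineHyp.ext_half fun i => ?_
  obtain ⟨k, hk⟩ := exists_apply_eq_of_mem_congruenceSubgroup hw (i : ℕ)
  have h := SelfConjCore.levelCoord_levelSMul hs hst w lam (i : ℕ)
  rw [show levelSMul hs hst w lam = lam from h_stab, hk, SelfConjCore.levelCoord_add_mul,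
    sub_eq_self] at h
  have ht : (t : ℤ) ≠ 0 := by
    have := mul_pos_of_coprime hs hst le_rfl
    lia
  rw [hk, (mul_eq_zero.1 h).resolve_right ht, add_zero]
  rfl

theorem exists_levelSMul_eq_of_coreEquiv (hs : 2 ≤ s) (hst : s.Coprime t) (hnt : 0 < n * t)
    {lam mu : SelfConjCore s} (h : CoreEquiv s (n * t) lam.1 mu.1) :
    ∃ w ∈ congruenceSubgroup hs n, levelSMul hs hst w lam = mu := by
  have hs0 := Nat.zero_lt_of_lt hs
  rw [SelfConjCore.coreEquiv_iff_levelCoord_modEq hs0 hst] at h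
  choose k hk using fun i => (h i).dvd
  have h_ne : ((n * t : ℕ) : ℤ) * s ≠ 0 := by positivity
  have h_add_period (nu : SelfConjCore s) (i : ℤ) :
      nu.levelCoord hs0 t (i + s) = nu.levelCoord hs0 t i - s * t := by
    simpa using nu.levelCoord_add_mul hs0 t i 1
  obtain ⟨w, hw, h_apply⟩ := exists_mem_congruenceSubgroup_apply_eq (hs := hs) (n := n) (k := k)
    (fun i => mul_left_cancel₀ h_ne <| by
      rw [← hk, ← hk, h_add_period, h_add_period]
      ring)
    (fun i => mul_left_cancel₀ h_ne <| by
      rw [mul_neg, ← hk, ← hk, lam.levelCoord_reflect hs0 hst, mu.levelCoord_reflect hs0 hst]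
      ring)
  refine ⟨w, hw, SelfConjCore.eq_of_levelCoord_eq hs0 hst fun j => ?_⟩
  obtain ⟨i, rfl⟩ := (w : Equiv.Perm ℤ).surjective j
  have hki := hk i
  push_cast at hki
  rw [SelfConjCore.levelCoord_levelSMul, h_apply, SelfConjCore.levelCoord_add_mul]
  linear_combination -hki

/-- The stabiliser of a core under the level `t` action of the affine hyperoctahedral group on the
self-conjugate `s`-cores of spread less than `N s`. -/
noncomputable def boundedStab (hs : 2 ≤ s) (hst : s.Coprime t) {N : ℕ} (hN : 0 < N)
    (lam : BoundedSelfConjCore s N) : Subgroup (AffineHyp hs) :=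
  letI := boundedLevelAction hs hst hN
  MulAction.stabilizer (AffineHyp hs) lam

theorem mem_boundedStab {hst : s.Coprime t} {N : ℕ} {hN : 0 < N}
    {lam : BoundedSelfConjCore s N} {w : AffineHyp hs} :
    w ∈ boundedStab hs hst hN lam ↔ CoreEquiv s N (levelSMul hs hst w lam.1).1 lam.1.1 := by
  refine ⟨fun h => ?_, eq_boundedLevelSMul hs hst hN w lam lam⟩
  have h_equiv := coreEquiv_boundedLevelSMul hs hst hN w lam
  rwa [show boundedLevelSMul hs hst hN w lam = lam from h] at h_equiv

theorem boundedStab_eq_sup (hs : 2 ≤ s) (hst : s.Coprime t) (hnt : 0 < n * t)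
    (lam : BoundedSelfConjCore s (n * t)) :
    boundedStab hs hst hnt lam = stabSC hs hst lam.1 ⊔ congruenceSubgroup hs n := by
  refine le_antisymm (fun w hw => ?_) (sup_le (fun w hw => ?_) fun w hw => ?_)
  · obtain ⟨v, hv, h⟩ := exists_levelSMul_eq_of_coreEquiv hs hst hnt (mem_boundedStab.1 hw)
    rw [← mul_levelSMul] at h
    rw [← inv_mul_cancel_left v w]
    exact mul_mem (inv_mem (Subgroup.mem_sup_right hv)) (Subgroup.mem_sup_left h)
  · rw [mem_boundedStab, show levelSMul hs hst w lam.1 = lam.1 from hw]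
    exact ⟨Equiv.refl _, fun _ => Int.ModEq.refl _⟩
  · exact mem_boundedStab.2 (coreEquiv_levelSMul_of_mem_congruenceSubgroup hst hw lam.1)

theorem card_mul_index_sup_of_disjoint {G : Type*} [Group G] {K L : Subgroup G} [L.Normal]
    (h : Disjoint K L) : Nat.card K * (K ⊔ L).index = L.index := by
  rw [← Subgroup.relIndex_mul_index (le_sup_right : L ≤ K ⊔ L), Subgroup.relIndex_sup_right,
    ← Subgroup.inf_relIndex_right, h.symm.eq_bot, Subgroup.relIndex_bot_left]

theorem card_levelOrbit (hs : 2 ≤ s) (hst : s.Coprime t) {N : ℕ} (hN : 0 < N)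
    (lam : BoundedSelfConjCore s N) :
    Nat.card (levelOrbit hs hst hN lam) = (boundedStab hs hst hN lam).index :=
  letI := boundedLevelAction hs hst hN
  (MulAction.index_stabilizer (AffineHyp hs) lam).symm

theorem card_stabSC_mul_card_levelOrbit (hs : 2 ≤ s) (hst : s.Coprime t) (hnt : 0 < n * t)
    (lam : BoundedSelfConjCore s (n * t)) :
    Nat.card (stabSC hs hst lam.1) * Nat.card (levelOrbit hs hst hnt lam) =
      (2 * n) ^ (s / 2) * (s / 2).factorial := by
  rw [card_levelOrbit, boundedStab_eq_sup,
    card_mul_index_sup_of_disjoint (disjoint_stabSC_congruenceSubgroup hst n lam.1),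
    index_congruenceSubgroup]

end Stabilisers

end SCCore

theorem mainTheorem6 (s t n : ℕ) (hs : 2 ≤ s) (hst : s.Coprime t) (hn : 1 ≤ n)
    (lam : SCCore.BoundedSelfConjCore s (n * t)) :
    Finite (SCCore.stabSC hs hst lam.1) ∧
    (SCCore.levelOrbit hs hst (SCCore.mul_pos_of_coprime hs hst hn) lam).Finite ∧
    (Nat.card (SCCore.levelOrbit hs hst (SCCore.mul_pos_of_coprime hs hst hn) lam) : ℚ) =
      ((2 * n) ^ (s / 2) * (s / 2).factorial : ℚ) / Nat.card (SCCore.stabSC hs hst lam.1) := by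
  have h_card := SCCore.card_stabSC_mul_card_levelOrbit hs hst
    (SCCore.mul_pos_of_coprime hs hst hn) lam
  have h_ne : (2 * n) ^ (s / 2) * (s / 2).factorial ≠ 0 := by positivity
  rw [← h_card] at h_ne
  have h_stab := left_ne_zero_of_mul h_ne
  have h_orbit := right_ne_zero_of_mul h_ne
  refine ⟨Nat.finite_of_card_ne_zero h_stab, Nat.finite_of_card_ne_zero h_orbit, ?_⟩
  rw [eq_div_iff (by exact_mod_cast h_stab), mul_comm]
  exact_mod_cast h_card
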